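/- Let $k$ be a field and let $A=\bigoplus_{m\ge 0}A_m$ be a graded $k$-algebra which is finitely generated as a $k$-algebra and right graded coherent, that is, every finitely generated homogeneous right ideal of $A$ is finitely presented as a right $A$-module. Let $\mathsf{Gr}(A)$ be the abelian category of $\mathbb Z$-graded right $A$-modules and $A$-linear maps of degree zero, and let $\mathsf{gr}(A)$ be its full (abelian) subcategory of finitely presented modules. Call a graded module torsion if it is the sum of its finite-dimensional graded submodules, let $\mathsf{Tors}(A)\subset\mathsf{Gr}(A)$ and $\mathsf{tors}(A)=\mathsf{Tors}(A)\cap\mathsf{gr}(A)\subset\mathsf{gr}(A)$ be the Serre subcategories of torsion modules, and put $\mathsf{Qgr}(A)=\mathsf{Gr}(A)/\mathsf{Tors}(A)$, $\mathsf{qgr}(A)=\mathsf{gr}(A)/\mathsf{tors}(A)$, with quotient functors $\pi\colon\mathsf{Gr}(A)\to\mathsf{Qgr}(A)$ and $p\colon\mathsf{gr}(A)\to\mathsf{qgr}(A)$. An object $X$ of $\mathsf{Qgr}(A)$ is of finite type if every family of subobjects of $X$ with sum $X$ has a finite subfamily with sum $X$; it is finitely presented if it is of finite type and, for every epimorphism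 $q\colon Y\to X$ with $Y$ of finite type, $\ker q$ is of finite type. Let $\mathsf{fp}(\mathsf{Qgr}(A))$ be the full subcategory of finitely presented objects. Then the inclusion $i\colon\mathsf{gr}(A)\to\mathsf{Gr}(A)$ induces an equivalence of categories $\mathsf{qgr}(A)\simeq\mathsf{fp}(\mathsf{Qgr}(A))$: there is an equivalence $E\colon\mathsf{qgr}(A)\to\mathsf{fp}(\mathsf{Qgr}(A))$ such that the composite of $E\circ p$ with the inclusion $\mathsf{fp}(\mathsf{Qgr}(A))\to\mathsf{Qgr}(A)$ is naturally isomorphic to $\pi\circ i$. -/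

import Mathlib

open CategoryTheory CategoryTheory.Limits MulOpposite DirectSum

universe w u

section GradedModules

variable {k : Type w} [Field k] {A : Type u} [Ring A] [Algebra k A]

/-- A `ℤ`-graded right module over the graded `k`-algebra `A = ⨁ 𝒜 m`.  Right `A`-modules are
modules over `Aᵐᵒᵖ`; the homogeneous components are `k`-subspaces. -/
structure GrMod (𝒜 : ℕ → Submodule k A) where
  carrier : Type u
  [addCommGroup : AddCommGroup carrier]
  [moduleBase : Module k carrier]
  [module : Module Aᵐᵒᵖ carrier]
  [isScalarTower : IsScalarTower k Aᵐᵒᵖ carrier]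
  deg : ℤ → Submodule k carrier
  isInternal : DirectSum.IsInternal deg
  smul_mem : ∀ {m : ℕ} {i : ℤ} {a : A} {x : carrier},
    a ∈ 𝒜 m → x ∈ deg i → op a • x ∈ deg (i + m)

namespace GrMod

variable {𝒜 : ℕ → Submodule k A}

instance : CoeSort (GrMod 𝒜) (Type u) := ⟨GrMod.carrier⟩

attribute [instance] addCommGroup moduleBase module isScalarTower

noncomputable instance (M : GrMod 𝒜) : DirectSum.Decomposition M.deg :=
  M.isInternal.chooseDecomposition

/-- Morphisms of graded modules: `A`-linear maps of degree zero. -/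
@[ext]
structure Hom (M N : GrMod 𝒜) where
  lin : M →ₗ[Aᵐᵒᵖ] N
  map_mem : ∀ (i : ℤ) (x : M), x ∈ M.deg i → lin x ∈ N.deg i

/-- The category `Gr(A)` of `ℤ`-graded right `A`-modules. -/
instance : Category (GrMod 𝒜) where
  Hom M N := Hom M N
  id M := ⟨LinearMap.id, fun _ _ h => h⟩
  comp f g := ⟨g.lin ∘ₗ f.lin, fun i x h => g.map_mem i _ (f.map_mem i x h)⟩

@[ext]
lemma hom_ext {M N : GrMod 𝒜} {f g : M ⟶ N} (h : ∀ x, f.lin x = g.lin x) : f = g :=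
  Hom.ext (LinearMap.ext h)

@[simp] lemma id_lin (M : GrMod 𝒜) : (𝟙 M : M ⟶ M).lin = LinearMap.id := rfl

@[simp] lemma comp_lin {M N P : GrMod 𝒜} (f : M ⟶ N) (g : N ⟶ P) :
    (f ≫ g).lin = g.lin ∘ₗ f.lin := rfl

section Preadditive

variable (M N : GrMod 𝒜)

instance : Zero (M ⟶ N) := ⟨⟨0, fun i _ _ => (N.deg i).zero_mem⟩⟩
instance : Add (M ⟶ N) :=
  ⟨fun f g => ⟨f.lin + g.lin, fun i x h => (N.deg i).add_mem (f.map_mem i x h) (g.map_mem i x h)⟩⟩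
instance : Neg (M ⟶ N) :=
  ⟨fun f => ⟨-f.lin, fun i x h => (N.deg i).neg_mem (f.map_mem i x h)⟩⟩
instance : Sub (M ⟶ N) :=
  ⟨fun f g => ⟨f.lin - g.lin, fun i x h => (N.deg i).sub_mem (f.map_mem i x h) (g.map_mem i x h)⟩⟩
instance : SMul ℕ (M ⟶ N) :=
  ⟨fun n f => ⟨n • f.lin, fun i x h => nsmul_mem (f.map_mem i x h) n⟩⟩
instance : SMul ℤ (M ⟶ N) :=
  ⟨fun n f => ⟨n • f.lin, fun i x h => zsmul_mem (f.map_mem i x h) n⟩⟩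

lemma lin_injective : Function.Injective (fun f : M ⟶ N => f.lin) := fun _ _ h => Hom.ext h

instance : AddCommGroup (M ⟶ N) :=
  (lin_injective M N).addCommGroup _ rfl (fun _ _ => rfl) (fun _ => rfl) (fun _ _ => rfl)
    (fun _ _ => rfl) (fun _ _ => rfl)

variable {M N}

@[simp] lemma zero_lin : (0 : M ⟶ N).lin = 0 := rfl
@[simp] lemma add_lin (f g : M ⟶ N) : (f + g).lin = f.lin + g.lin := rfl
@[simp] lemma sub_lin (f g : M ⟶ N) : (f - g).lin = f.lin - g.lin := rfl

instance : Preadditive (GrMod 𝒜) where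
  add_comp _ _ _ f f' g := by ext x; simp
  comp_add _ _ _ f g g' := by ext x; simp

end Preadditive

lemma isInternal_of_proj {M M' : Type*} [AddCommGroup M] [Module k M] [AddCommGroup M']
    [Module k M'] (D : ℤ → Submodule k M) (p : ℤ → M →ₗ[k] M')
    (h₁ : ∀ i x, x ∈ D i → p i x = 0 → x = 0)
    (h₂ : ∀ i j x, i ≠ j → x ∈ D j → p i x = 0)
    (h₃ : ∀ x, x ∈ ⨆ i, D i) : DirectSum.IsInternal D := by
  rw [DirectSum.isInternal_submodule_iff_iSupIndep_and_iSup_eq_top]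
  refine ⟨fun i => ?_, eq_top_iff.2 fun x _ => h₃ x⟩
  rw [Submodule.disjoint_def]
  intro x hx hx'
  refine h₁ i x hx ?_
  have : (⨆ j, ⨆ (_ : j ≠ i), D j) ≤ LinearMap.ker (p i) :=
    iSup₂_le fun j hj y hy => h₂ i j y hj.symm hy
  exact this hx'

/-- The projection of a graded module to its component of degree `i`. -/
noncomputable def proj (M : GrMod 𝒜) (i : ℤ) : M →ₗ[k] M :=
  (M.deg i).subtype ∘ₗ DirectSum.component k ℤ (fun i => M.deg i) i ∘ₗ
    (DirectSum.decomposeLinearEquiv M.deg).toLinearMap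

lemma proj_apply (M : GrMod 𝒜) (i : ℤ) (x : M) :
    M.proj i x = (DirectSum.decompose M.deg x i : M) := rfl

lemma proj_mem (M : GrMod 𝒜) (i : ℤ) (x : M) : M.proj i x ∈ M.deg i :=
  (DirectSum.decompose M.deg x i).2

lemma proj_of_mem {M : GrMod 𝒜} {i : ℤ} {x : M} (h : x ∈ M.deg i) : M.proj i x = x :=
  DirectSum.decompose_of_mem_same _ h

lemma proj_of_mem_ne {M : GrMod 𝒜} {i j : ℤ} {x : M} (hij : i ≠ j) (h : x ∈ M.deg j) :
    M.proj i x = 0 :=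
  DirectSum.decompose_of_mem_ne _ h hij.symm

lemma exists_eq_sum_proj (M : GrMod 𝒜) (x : M) : ∃ s : Finset ℤ, ∑ i ∈ s, M.proj i x = x := by
  classical
  exact ⟨_, DirectSum.sum_support_decompose M.deg x⟩

lemma hom_induction {M : GrMod 𝒜} {p : M → Prop} (x : M) (h0 : p 0)
    (hadd : ∀ x y, p x → p y → p (x + y)) (hd : ∀ i, ∀ x ∈ M.deg i, p x) : p x := by
  obtain ⟨s, hs⟩ := M.exists_eq_sum_proj x
  rw [← hs]
  exact Finset.sum_induction _ p hadd h0 fun i _ => hd i _ (M.proj_mem i x)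

lemma map_proj {M N : GrMod 𝒜} (f : M ⟶ N) (i : ℤ) (x : M) :
    f.lin (M.proj i x) = N.proj i (f.lin x) := by
  refine hom_induction (p := fun x => f.lin (M.proj i x) = N.proj i (f.lin x)) x (by simp)
    (fun x y hx hy => by simp [hx, hy]) fun j x hx => ?_
  by_cases hij : i = j
  · subst hij
    rw [proj_of_mem hx, proj_of_mem (f.map_mem _ _ hx)]
  · rw [proj_of_mem_ne hij hx, proj_of_mem_ne hij (f.map_mem _ _ hx), map_zero]

lemma proj_smul {M : GrMod 𝒜} {m : ℕ} {a : A} (ha : a ∈ 𝒜 m) (i : ℤ) (x : M) :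
    M.proj i (op a • x) = op a • M.proj (i - m) x := by
  refine hom_induction (p := fun x => M.proj i (op a • x) = op a • M.proj (i - m) x) x (by simp)
    (fun x y hx hy => by simp [hx, hy]) fun j x hx => ?_
  by_cases hij : i = j + m
  · subst hij
    rw [proj_of_mem (M.smul_mem ha hx), add_sub_cancel_right, proj_of_mem hx]
  · rw [proj_of_mem_ne hij (M.smul_mem ha hx), proj_of_mem_ne (fun h => hij (by omega)) hx,
      smul_zero]

/-! ### Graded submodules and quotients -/

/-- A submodule of a graded module is homogeneous (a graded submodule) if it contains the
homogeneous components of its elements. -/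
abbrev IsHomog (M : GrMod 𝒜) (N : Submodule Aᵐᵒᵖ M) : Prop := N.IsHomogeneous M.deg

lemma IsHomog.proj_mem {M : GrMod 𝒜} {N : Submodule Aᵐᵒᵖ M} (h : M.IsHomog N) {x : M}
    (hx : x ∈ N) (i : ℤ) : M.proj i x ∈ N := h i hx

lemma isHomog_ker {M N : GrMod 𝒜} (f : M ⟶ N) : M.IsHomog (LinearMap.ker f.lin) := by
  intro i x hx
  change f.lin (M.proj i x) = 0
  rw [map_proj, show f.lin x = 0 from hx, map_zero]

lemma IsHomog.map {M N : GrMod 𝒜} (f : M ⟶ N) {P : Submodule Aᵐᵒᵖ M} (hP : M.IsHomog P) :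
    N.IsHomog (P.map f.lin) := by
  rintro i _ ⟨x, hx, rfl⟩
  exact ⟨M.proj i x, hP i hx, map_proj f i x⟩

lemma IsHomog.comap {M N : GrMod 𝒜} (f : M ⟶ N) {P : Submodule Aᵐᵒᵖ N} (hP : N.IsHomog P) :
    M.IsHomog (P.comap f.lin) := by
  intro i x hx
  change f.lin (M.proj i x) ∈ P
  rw [map_proj]
  exact hP i hx

lemma isHomog_top (M : GrMod 𝒜) : M.IsHomog ⊤ := fun _ _ _ => trivial

lemma isHomog_range {M N : GrMod 𝒜} (f : M ⟶ N) : N.IsHomog (LinearMap.range f.lin) := by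
  rw [← Submodule.map_top]
  exact (isHomog_top M).map f

/-- A homogeneous submodule as a graded module. -/
def sub (M : GrMod 𝒜) (N : Submodule Aᵐᵒᵖ M) (hN : M.IsHomog N) : GrMod 𝒜 where
  carrier := N
  deg i := (M.deg i).comap (N.subtype.restrictScalars k)
  isInternal := by
    refine isInternal_of_proj _ (fun i => M.proj i ∘ₗ N.subtype.restrictScalars k) ?_ ?_ ?_
    · intro i x hx h
      have : M.proj i (x : M) = x := proj_of_mem hx
      exact Subtype.ext (this.symm.trans h)
    · intro i j x hij hx
      exact proj_of_mem_ne (x := (x : M)) hij hx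
    · intro x
      obtain ⟨s, hs⟩ := M.exists_eq_sum_proj x
      have : x = ∑ i ∈ s, (⟨M.proj i x, hN.proj_mem x.2 i⟩ : N) := by
        ext; simpa using hs.symm
      rw [this]
      exact Submodule.sum_mem _ fun i _ => Submodule.mem_iSup_of_mem i (M.proj_mem i x)
  smul_mem ha hx := M.smul_mem ha hx

/-- The inclusion of a homogeneous submodule. -/
def subι (M : GrMod 𝒜) (N : Submodule Aᵐᵒᵖ M) (hN : M.IsHomog N) : M.sub N hN ⟶ M :=
  ⟨N.subtype, fun _ _ h => h⟩

/-- The quotient of a graded module by a homogeneous submodule. -/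
def quot (M : GrMod 𝒜) (N : Submodule Aᵐᵒᵖ M) (hN : M.IsHomog N) : GrMod 𝒜 where
  carrier := M ⧸ N
  deg i := (M.deg i).map (N.mkQ.restrictScalars k)
  isInternal := by
    have key : ∀ i, N.restrictScalars k ≤
        LinearMap.ker (N.mkQ.restrictScalars k ∘ₗ M.proj i) := fun i x hx => by
      simpa using hN.proj_mem hx i
    refine isInternal_of_proj _
      (fun i => (N.restrictScalars k).liftQ (N.mkQ.restrictScalars k ∘ₗ M.proj i) (key i)) ?_ ?_ ?_
    · rintro i _ ⟨x, hx, rfl⟩ h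
      have h' : N.mkQ (M.proj i x) = 0 := h
      rw [proj_of_mem hx] at h'
      exact h'
    · rintro i j _ hij ⟨x, hx, rfl⟩
      change N.mkQ (M.proj i x) = 0
      rw [proj_of_mem_ne hij hx, map_zero]
    · intro x
      obtain ⟨x, rfl⟩ := N.mkQ_surjective x
      obtain ⟨s, hs⟩ := M.exists_eq_sum_proj x
      rw [← hs, map_sum]
      exact Submodule.sum_mem _ fun i _ =>
        Submodule.mem_iSup_of_mem i ⟨_, M.proj_mem i x, rfl⟩
  smul_mem := by
    rintro m i a _ ha ⟨x, hx, rfl⟩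
    exact ⟨op a • x, M.smul_mem ha hx, rfl⟩

/-- The projection to the quotient by a homogeneous submodule. -/
def quotπ (M : GrMod 𝒜) (N : Submodule Aᵐᵒᵖ M) (hN : M.IsHomog N) : M ⟶ M.quot N hN :=
  ⟨N.mkQ, fun _ x h => ⟨x, h, rfl⟩⟩

/-- The direct sum of two graded modules. -/
def prod (M N : GrMod 𝒜) : GrMod 𝒜 where
  carrier := M × N
  deg i := (M.deg i).prod (N.deg i)
  isInternal := by
    refine isInternal_of_proj _ (fun i => (M.proj i).prodMap (N.proj i)) ?_ ?_ ?_
    · rintro i ⟨x, y⟩ ⟨hx, hy⟩ h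
      have h₁ : M.proj i x = 0 := congrArg Prod.fst h
      have h₂ : N.proj i y = 0 := congrArg Prod.snd h
      rw [proj_of_mem hx] at h₁
      rw [proj_of_mem hy] at h₂
      exact Prod.ext h₁ h₂
    · rintro i j ⟨x, y⟩ hij ⟨hx, hy⟩
      exact Prod.ext (proj_of_mem_ne hij hx) (proj_of_mem_ne hij hy)
    · rintro ⟨x, y⟩
      have hx : ((x, 0) : M × N) ∈ ⨆ i, (M.deg i).prod (N.deg i) := by
        obtain ⟨s, hs⟩ := M.exists_eq_sum_proj x
        have : ((x, 0) : M × N) = ∑ i ∈ s, (M.proj i x, 0) := by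
          ext <;> simp [Prod.fst_sum, Prod.snd_sum, hs]
        rw [this]
        exact Submodule.sum_mem _ fun i _ =>
          Submodule.mem_iSup_of_mem i ⟨M.proj_mem i x, (N.deg i).zero_mem⟩
      have hy : ((0, y) : M × N) ∈ ⨆ i, (M.deg i).prod (N.deg i) := by
        obtain ⟨s, hs⟩ := N.exists_eq_sum_proj y
        have : ((0, y) : M × N) = ∑ i ∈ s, (0, N.proj i y) := by
          ext <;> simp [Prod.fst_sum, Prod.snd_sum, hs]
        rw [this]
        exact Submodule.sum_mem _ fun i _ =>
          Submodule.mem_iSup_of_mem i ⟨(M.deg i).zero_mem, N.proj_mem i y⟩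
      simpa using add_mem hx hy
  smul_mem ha hx := ⟨M.smul_mem ha hx.1, N.smul_mem ha hx.2⟩

/-- The zero graded module. -/
def zero (𝒜 : ℕ → Submodule k A) : GrMod 𝒜 where
  carrier := PUnit
  deg _ := ⊥
  isInternal := isInternal_of_proj (M' := PUnit.{1}) _ (fun _ => 0) (fun _ _ _ _ => rfl)
    (fun _ _ _ _ _ => rfl) (fun x => by
      rw [Subsingleton.elim x 0]; exact Submodule.zero_mem _)
  smul_mem _ _ := Subsingleton.elim _ _

/-! ### The abelian structure -/

section Abelian

lemma isZero_zero : IsZero (zero 𝒜) := by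
  rw [IsZero.iff_id_eq_zero]
  ext x
  exact Subsingleton.elim (α := PUnit) _ _

instance : HasZeroObject (GrMod 𝒜) := ⟨_, isZero_zero⟩

variable {M N : GrMod 𝒜} (f : M ⟶ N)

/-- Lift of a morphism to a homogeneous submodule. -/
def subLift {T : GrMod 𝒜} (g : T ⟶ M) (P : Submodule Aᵐᵒᵖ M) (hP : M.IsHomog P)
    (h : ∀ x, g.lin x ∈ P) : T ⟶ M.sub P hP :=
  ⟨g.lin.codRestrict P h, fun i x hx => g.map_mem i x hx⟩

/-- Descent of a morphism to the quotient by a homogeneous submodule. -/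
def quotDesc {T : GrMod 𝒜} (g : M ⟶ T) (P : Submodule Aᵐᵒᵖ M) (hP : M.IsHomog P)
    (h : ∀ x ∈ P, g.lin x = 0) : M.quot P hP ⟶ T :=
  ⟨P.liftQ g.lin h, by rintro i _ ⟨x, hx, rfl⟩; exact g.map_mem i x hx⟩

lemma subι_lin_apply (P : Submodule Aᵐᵒᵖ M) (hP : M.IsHomog P) (x : P) :
    (M.subι P hP).lin x = (x : M) := rfl

/-- The kernel of a morphism, with its universal property. -/
def kernelIsLimit : IsLimit (KernelFork.ofι (f := f) (M.subι _ (isHomog_ker f))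
    (by ext x; exact x.2)) :=
  KernelFork.IsLimit.ofι _ _
    (fun g hg => subLift g _ _ fun x => congrArg (fun h => Hom.lin h x) hg)
    (fun _ _ => rfl)
    (fun g hg m hm => by
      ext x
      exact Subtype.ext (congrArg (fun h => Hom.lin h x) hm))

/-- The cokernel of a morphism, with its universal property. -/
def cokernelIsColimit : IsColimit (CokernelCofork.ofπ (f := f) (N.quotπ _ (isHomog_range f))
    (by ext x; exact (Submodule.Quotient.mk_eq_zero _).2 ⟨x, rfl⟩)) :=
  CokernelCofork.IsColimit.ofπ _ _
    (fun g hg => quotDesc g _ _ (by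
      rintro _ ⟨x, rfl⟩
      exact congrArg (fun h => Hom.lin h x) hg))
    (fun _ _ => rfl)
    (fun g hg m hm => by
      ext x
      obtain ⟨x, rfl⟩ := Submodule.mkQ_surjective _ x
      exact congrArg (fun h => Hom.lin h x) hm)

instance : HasKernels (GrMod 𝒜) := ⟨fun f => ⟨⟨_, kernelIsLimit f⟩⟩⟩

instance : HasCokernels (GrMod 𝒜) := ⟨fun f => ⟨⟨_, cokernelIsColimit f⟩⟩⟩

/-- The universal property of the direct sum. -/
def prodIsLimit (M N : GrMod 𝒜) : IsLimit (BinaryFan.mk (P := M.prod N)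
    (⟨LinearMap.fst _ _ _, fun _ _ h => h.1⟩ : M.prod N ⟶ M)
    (⟨LinearMap.snd _ _ _, fun _ _ h => h.2⟩ : M.prod N ⟶ N)) :=
  BinaryFan.IsLimit.mk _
    (fun f g => ⟨f.lin.prod g.lin, fun i x h => ⟨f.map_mem i x h, g.map_mem i x h⟩⟩)
    (fun _ _ => rfl) (fun _ _ => rfl)
    (fun f g m h₁ h₂ => by
      ext x
      exact Prod.ext (congrArg (fun h => Hom.lin h x) h₁) (congrArg (fun h => Hom.lin h x) h₂))

instance : HasBinaryProducts (GrMod 𝒜) :=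
  have (M N : GrMod 𝒜) : HasLimit (pair M N) := ⟨⟨_, prodIsLimit M N⟩⟩
  hasBinaryProducts_of_hasLimit_pair _

instance : HasFiniteProducts (GrMod 𝒜) :=
  hasFiniteProducts_of_has_binary_and_terminal

lemma injective_of_mono [Mono f] : Function.Injective f.lin := by
  rw [← LinearMap.ker_eq_bot, eq_bot_iff]
  intro x hx
  have h : M.subι _ (isHomog_ker f) = 0 := by
    rw [← cancel_mono f, zero_comp]
    ext y
    exact y.2
  exact congrArg (fun g => Hom.lin g (⟨x, hx⟩ : LinearMap.ker f.lin)) h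

lemma surjective_of_epi [Epi f] : Function.Surjective f.lin := by
  rw [← LinearMap.range_eq_top, eq_top_iff]
  intro x _
  have h : N.quotπ _ (isHomog_range f) = 0 := by
    rw [← cancel_epi f, comp_zero]
    ext y
    exact (Submodule.Quotient.mk_eq_zero _).2 ⟨y, rfl⟩
  exact (Submodule.Quotient.mk_eq_zero _).1 (congrArg (fun g => Hom.lin g x) h)

lemma mem_deg_of_injective (hf : Function.Injective f.lin) {i : ℤ} {x : M}
    (hx : f.lin x ∈ N.deg i) : x ∈ M.deg i := by
  have : x = M.proj i x := hf (by rw [map_proj, proj_of_mem hx])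
  rw [this]
  exact M.proj_mem i x

/-- Lift of a morphism through an injective morphism. -/
noncomputable def monoLift (hf : Function.Injective f.lin) {T : GrMod 𝒜} (g : T ⟶ N)
    (hr : ∀ x, g.lin x ∈ LinearMap.range f.lin) : T ⟶ M :=
  ⟨(LinearEquiv.ofInjective f.lin hf).symm.toLinearMap ∘ₗ g.lin.codRestrict _ hr, fun i x hx =>
    mem_deg_of_injective f hf (by
      have h : f.lin ((LinearEquiv.ofInjective f.lin hf).symm (g.lin.codRestrict _ hr x)) =
          g.lin x :=
        congrArg Subtype.val ((LinearEquiv.ofInjective f.lin hf).apply_symm_apply _)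
      rw [LinearMap.comp_apply, LinearEquiv.coe_coe, h]
      exact g.map_mem i x hx)⟩

lemma monoLift_comp (hf : Function.Injective f.lin) {T : GrMod 𝒜} (g : T ⟶ N)
    (hr : ∀ x, g.lin x ∈ LinearMap.range f.lin) : monoLift f hf g hr ≫ f = g := by
  ext x
  exact congrArg Subtype.val ((LinearEquiv.ofInjective f.lin hf).apply_symm_apply _)

lemma exists_mem_deg_of_surjective (hf : Function.Surjective f.lin) {i : ℤ} {y : N}
    (hy : y ∈ N.deg i) : ∃ x ∈ M.deg i, f.lin x = y := by
  obtain ⟨x, rfl⟩ := hf y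
  exact ⟨M.proj i x, M.proj_mem i x, by rw [map_proj, proj_of_mem hy]⟩

/-- Descent of a morphism along a surjective morphism. -/
noncomputable def epiDesc (hf : Function.Surjective f.lin) {T : GrMod 𝒜} (g : M ⟶ T)
    (hk : LinearMap.ker f.lin ≤ LinearMap.ker g.lin) : N ⟶ T :=
  ⟨(LinearMap.ker f.lin).liftQ g.lin hk ∘ₗ
      (f.lin.quotKerEquivOfSurjective hf).symm.toLinearMap, by
    intro i y hy
    obtain ⟨x, hx, rfl⟩ := exists_mem_deg_of_surjective f hf hy
    have h : (f.lin.quotKerEquivOfSurjective hf).symm (f.lin x) =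
        (LinearMap.ker f.lin).mkQ x := by
      rw [LinearEquiv.symm_apply_eq]; rfl
    rw [LinearMap.comp_apply, LinearEquiv.coe_coe, h]
    exact g.map_mem i x hx⟩

lemma comp_epiDesc (hf : Function.Surjective f.lin) {T : GrMod 𝒜} (g : M ⟶ T)
    (hk : LinearMap.ker f.lin ≤ LinearMap.ker g.lin) : f ≫ epiDesc f hf g hk = g := by
  ext x
  have h : (f.lin.quotKerEquivOfSurjective hf).symm (f.lin x) =
      (LinearMap.ker f.lin).mkQ x := by
    rw [LinearEquiv.symm_apply_eq]; rfl
  change (LinearMap.ker f.lin).liftQ g.lin hk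
    ((f.lin.quotKerEquivOfSurjective hf).symm (f.lin x)) = g.lin x
  rw [h]
  rfl

/-- Every monomorphism of graded modules is the kernel of its cokernel. -/
instance : IsNormalMonoCategory (GrMod 𝒜) := ⟨fun {M N} f _ => ⟨{
  Z := N.quot _ (isHomog_range f)
  g := N.quotπ _ (isHomog_range f)
  w := by ext x; exact (Submodule.Quotient.mk_eq_zero _).2 ⟨x, rfl⟩
  isLimit := KernelFork.IsLimit.ofι _ _
    (fun {T} g hg => monoLift f (injective_of_mono f) g fun x =>
      (Submodule.Quotient.mk_eq_zero _).1 (congrArg (fun h => Hom.lin h x) hg))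
    (fun g hg => monoLift_comp f _ g _)
    (fun g hg m hm => by rw [← cancel_mono f, hm, monoLift_comp]) }⟩⟩

/-- Every epimorphism of graded modules is the cokernel of its kernel. -/
instance : IsNormalEpiCategory (GrMod 𝒜) := ⟨fun {M N} f _ => ⟨{
  W := M.sub _ (isHomog_ker f)
  g := M.subι _ (isHomog_ker f)
  w := by ext x; exact x.2
  isColimit := CokernelCofork.IsColimit.ofπ _ _
    (fun {T} g hg => epiDesc f (surjective_of_epi f) g fun x hx =>
      LinearMap.congr_fun (congrArg Hom.lin hg) (⟨x, hx⟩ : LinearMap.ker f.lin))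
    (fun g hg => comp_epiDesc f _ g _)
    (fun g hg m hm => by rw [← cancel_epi f]; exact hm.trans (comp_epiDesc f _ g _).symm) }⟩⟩

/-- `Gr(A)` is an abelian category. -/
instance : Abelian (GrMod 𝒜) where

end Abelian

/-! ### Torsion modules -/

section Torsion

/-- A graded module is torsion if it is the sum of its finite-dimensional graded submodules. -/
def IsTorsion (M : GrMod 𝒜) : Prop :=
  sSup {N : Submodule Aᵐᵒᵖ M | M.IsHomog N ∧ Module.Finite k N} = ⊤

lemma finite_of_le {M : GrMod 𝒜} {N P : Submodule Aᵐᵒᵖ M} (h : N ≤ P) [Module.Finite k P] :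
    Module.Finite k N :=
  Module.Finite.of_injective ((Submodule.inclusion h).restrictScalars k)
    (Submodule.inclusion_injective h)

lemma finite_sup {M : GrMod 𝒜} (N P : Submodule Aᵐᵒᵖ M) [Module.Finite k N] [Module.Finite k P] :
    Module.Finite k (N ⊔ P : Submodule Aᵐᵒᵖ M) := by
  let f : N × P →ₗ[k] (N ⊔ P : Submodule Aᵐᵒᵖ M) :=
    ((Submodule.inclusion (le_sup_left : N ≤ N ⊔ P)).coprod
      (Submodule.inclusion (le_sup_right : P ≤ N ⊔ P))).restrictScalars k
  refine Module.Finite.of_surjective f ?_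
  rintro ⟨x, hx⟩
  obtain ⟨y, hy, z, hz, rfl⟩ := Submodule.mem_sup.1 hx
  exact ⟨(⟨y, hy⟩, ⟨z, hz⟩), rfl⟩

/-- If `A` is finitely generated and a finite-dimensional subspace `V` of a module is mapped
into `V + K` by the generators of `A`, for a submodule `K`, then `V + U` is stable under `A`
for some finitely generated submodule `U` of `K`. -/
lemma exists_stable (M : GrMod 𝒜) (s : Finset A) (hs : Algebra.adjoin k (s : Set A) = ⊤)
    (K : Submodule Aᵐᵒᵖ M) (V : Submodule k M) (hV : V.FG)
    (h : ∀ a ∈ s, ∀ v ∈ V, ∃ u ∈ K, op a • v - u ∈ V) :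
    ∃ U : Submodule Aᵐᵒᵖ M, U.FG ∧ U ≤ K ∧
      ∀ (a : A), ∀ v ∈ V ⊔ U.restrictScalars k, op a • v ∈ V ⊔ U.restrictScalars k := by
  classical
  obtain ⟨b, rfl⟩ := hV
  choose! u hu huV using h
  have hb : ∀ v ∈ b, v ∈ Submodule.span k (b : Set M) := fun v hv => Submodule.subset_span hv
  let T : Finset M := (s ×ˢ b).image fun p => u p.1 p.2
  refine ⟨Submodule.span Aᵐᵒᵖ T, ⟨T, rfl⟩, ?_, ?_⟩
  · rw [Submodule.span_le]
    intro y hy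
    obtain ⟨p, hp, rfl⟩ := Finset.mem_image.1 (Finset.mem_coe.1 hy)
    rw [Finset.mem_product] at hp
    exact hu _ hp.1 _ (hb _ hp.2)
  · intro a
    set W := Submodule.span k (b : Set M) ⊔ (Submodule.span Aᵐᵒᵖ (T : Set M)).restrictScalars k
    have ha : a ∈ Algebra.adjoin k (s : Set A) := by rw [hs]; trivial
    induction ha using Algebra.adjoin_induction with
    | mem a ha =>
      intro v hv
      obtain ⟨y, hy, z, hz, rfl⟩ := Submodule.mem_sup.1 hv
      rw [smul_add]
      refine add_mem ?_ (Submodule.mem_sup_right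
        ((Submodule.span Aᵐᵒᵖ (T : Set M)).smul_mem (op a) hz))
      induction hy using Submodule.span_induction with
      | mem y hy =>
        have : op a • y = (op a • y - u a y) + u a y := by abel
        rw [this]
        refine add_mem (Submodule.mem_sup_left (huV a ha y (hb y hy)))
          (Submodule.mem_sup_right (Submodule.subset_span ?_))
        exact Finset.mem_coe.2 (Finset.mem_image.2 ⟨(a, y), Finset.mem_product.2 ⟨ha, hy⟩, rfl⟩)
      | zero => simp
      | add y y' hy₀ hy₀' hy hy' =>
        rw [smul_add]
        exact add_mem (hy (add_mem (Submodule.mem_sup_left hy₀) (Submodule.mem_sup_right hz)))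
          (hy' (add_mem (Submodule.mem_sup_left hy₀') (Submodule.mem_sup_right hz)))
      | smul c y hy₀ hy =>
        rw [smul_comm]
        exact Submodule.smul_mem _ _
          (hy (add_mem (Submodule.mem_sup_left hy₀) (Submodule.mem_sup_right hz)))
    | algebraMap c =>
      intro v hv
      have : op (algebraMap k A c) • v = c • v := by
        rw [← MulOpposite.algebraMap_apply, algebraMap_smul]
      rw [this]
      exact Submodule.smul_mem _ _ hv
    | add a a' _ _ ha ha' =>
      intro v hv
      rw [MulOpposite.op_add, add_smul]
      exact add_mem (ha v hv) (ha' v hv)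
    | mul a a' _ _ ha ha' =>
      intro v hv
      rw [MulOpposite.op_mul, mul_smul]
      exact ha' _ (ha v hv)

lemma exact_apply {S : ShortComplex (GrMod 𝒜)} (hS : S.ShortExact) (x : S.X₂)
    (hx : S.g.lin x = 0) : ∃ y, S.f.lin y = x := by
  have := hS.mono_f
  obtain ⟨l, hl⟩ := KernelFork.IsLimit.lift' hS.fIsKernel (S.X₂.subι _ (isHomog_ker S.g))
    (by ext y; exact y.2)
  exact ⟨l.lin (⟨x, hx⟩ : LinearMap.ker S.g.lin),
    LinearMap.congr_fun (congrArg Hom.lin hl) (⟨x, hx⟩ : LinearMap.ker S.g.lin)⟩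

variable [GradedAlgebra 𝒜]

lemma isHomog_span_singleton {M : GrMod 𝒜} {i : ℤ} {x : M} (hx : x ∈ M.deg i) :
    M.IsHomog (Submodule.span Aᵐᵒᵖ {x}) := by
  intro j y hy
  obtain ⟨a, rfl⟩ := Submodule.mem_span_singleton.1 hy
  change M.proj j (a • x) ∈ _
  induction a using MulOpposite.rec' with
  | h a =>
    refine DirectSum.Decomposition.inductionOn 𝒜
      (motive := fun a => M.proj j (op a • x) ∈ Submodule.span Aᵐᵒᵖ {x}) (by simp) ?_ ?_ a
    · intro m a
      rw [proj_smul a.2]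
      refine Submodule.smul_mem _ _ ?_
      by_cases h : j - m = i
      · rw [h, proj_of_mem hx]; exact Submodule.mem_span_singleton_self x
      · rw [proj_of_mem_ne h hx]; exact Submodule.zero_mem _
    · intro a b ha hb
      rw [MulOpposite.op_add, add_smul, map_add]
      exact Submodule.add_mem _ ha hb

lemma isTorsion_iff (M : GrMod 𝒜) :
    M.IsTorsion ↔ ∀ x : M, Module.Finite k (Submodule.span Aᵐᵒᵖ {x}) := by
  constructor
  · intro h x
    have hx : x ∈ sSup {N : Submodule Aᵐᵒᵖ M | M.IsHomog N ∧ Module.Finite k N} := by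
      rw [show sSup _ = _ from h]; trivial
    rw [sSup_eq_iSup'] at hx
    refine Submodule.iSup_induction _
      (motive := fun x => Module.Finite k (Submodule.span Aᵐᵒᵖ {x})) hx ?_ ?_ ?_
    · rintro ⟨N, hN, hN'⟩ x hx
      exact finite_of_le (P := N) ((Submodule.span_singleton_le_iff_mem _ _).2 hx)
    · rw [Submodule.span_zero_singleton]
      infer_instance
    · intro x y hx hy
      have := finite_sup (Submodule.span Aᵐᵒᵖ {x}) (Submodule.span Aᵐᵒᵖ {y})
      refine finite_of_le (P := Submodule.span Aᵐᵒᵖ {x} ⊔ Submodule.span Aᵐᵒᵖ {y}) ?_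
      rw [Submodule.span_singleton_le_iff_mem]
      exact add_mem (Submodule.mem_sup_left (Submodule.mem_span_singleton_self x))
        (Submodule.mem_sup_right (Submodule.mem_span_singleton_self y))
  · intro h
    refine eq_top_iff.2 fun x _ => ?_
    refine hom_induction (p := fun x => x ∈
      sSup {N : Submodule Aᵐᵒᵖ M | M.IsHomog N ∧ Module.Finite k N}) x (Submodule.zero_mem _)
      (fun x y hx hy => Submodule.add_mem _ hx hy) fun i x hx => ?_
    exact (le_sSup (show Submodule.span Aᵐᵒᵖ {x} ∈ {N : Submodule Aᵐᵒᵖ M | M.IsHomog N ∧ Module.Finite k N}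
      from ⟨isHomog_span_singleton hx, h x⟩))
      (Submodule.mem_span_singleton_self x)

lemma IsTorsion.finite_of_fg {M : GrMod 𝒜} (hM : M.IsTorsion) {U : Submodule Aᵐᵒᵖ M}
    (hU : U.FG) : Module.Finite k U := by
  rw [isTorsion_iff] at hM
  induction U, hU using Submodule.fg_induction with
  | singleton x => exact hM x
  | sup N P hN hP => exact finite_sup N P

variable (𝒜) in
/-- The full subcategory `Tors(A)` of torsion modules in `Gr(A)`. -/
def Tors : ObjectProperty (GrMod 𝒜) := fun M => M.IsTorsion

/-- For a finitely generated algebra `A`, the torsion modules form a Serre subcategory. -/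
instance [Algebra.FiniteType k A] : (Tors 𝒜).IsSerreClass where
  exists_zero := by
    refine ⟨zero 𝒜, isZero_zero, (isTorsion_iff _).2 fun x => ?_⟩
    rw [show x = 0 from Subsingleton.elim (α := PUnit) _ _, Submodule.span_zero_singleton]
    infer_instance
  prop_of_mono {X Y} f _ hY := by
    refine (isTorsion_iff X).2 fun x => ?_
    have := (isTorsion_iff Y).1 hY (f.lin x)
    let g : Submodule.span Aᵐᵒᵖ {x} →ₗ[Aᵐᵒᵖ] Submodule.span Aᵐᵒᵖ {f.lin x} :=
      f.lin.restrict fun y hy => by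
        obtain ⟨a, rfl⟩ := Submodule.mem_span_singleton.1 hy
        rw [map_smul]
        exact Submodule.smul_mem _ _ (Submodule.mem_span_singleton_self _)
    exact Module.Finite.of_injective (g.restrictScalars k) fun y z h =>
      Subtype.ext (injective_of_mono f (congrArg Subtype.val h))
  prop_of_epi {X Y} f _ hX := by
    refine (isTorsion_iff Y).2 fun y => ?_
    obtain ⟨x, rfl⟩ := surjective_of_epi f y
    have := (isTorsion_iff X).1 hX x
    let g : Submodule.span Aᵐᵒᵖ {x} →ₗ[Aᵐᵒᵖ] Submodule.span Aᵐᵒᵖ {f.lin x} :=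
      f.lin.restrict fun y hy => by
        obtain ⟨a, rfl⟩ := Submodule.mem_span_singleton.1 hy
        rw [map_smul]
        exact Submodule.smul_mem _ _ (Submodule.mem_span_singleton_self _)
    refine Module.Finite.of_surjective (g.restrictScalars k) ?_
    rintro ⟨y, hy⟩
    obtain ⟨a, rfl⟩ := Submodule.mem_span_singleton.1 hy
    exact ⟨⟨a • x, Submodule.smul_mem _ _ (Submodule.mem_span_singleton_self _)⟩,
      Subtype.ext (map_smul f.lin a x)⟩
  prop_X₂_of_shortExact {S} hS h₁ h₃ := by
    classical
    have := hS.epi_g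
    have hg := surjective_of_epi S.g
    refine (isTorsion_iff S.X₂).2 fun x => ?_
    obtain ⟨s, hs⟩ := (inferInstance : Algebra.FiniteType k A).out
    have hB := (isTorsion_iff S.X₃).1 h₃ (S.g.lin x)
    set B := Submodule.span Aᵐᵒᵖ {S.g.lin x} with hBdef
    obtain ⟨V₀, hV₀, hVB⟩ : ∃ V₀ : Submodule k S.X₂, V₀.FG ∧
        V₀.map (S.g.lin.restrictScalars k) = B.restrictScalars k := by
      have hfg : (B.restrictScalars k).FG := Module.Finite.iff_fg.1 hB
      obtain ⟨t, ht⟩ := hfg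
      refine ⟨Submodule.span k (Function.surjInv hg '' t),
        ⟨t.image (Function.surjInv hg), by simp⟩, ?_⟩
      rw [Submodule.map_span, ← ht, Set.image_image]
      congr 1
      convert Set.image_id _ using 2
      exact funext fun y => Function.surjInv_eq hg y
    let V := V₀ ⊔ Submodule.span k {x}
    have hV : V.FG := hV₀.sup (Submodule.fg_span_singleton x)
    have hVB' : ∀ v ∈ V, S.g.lin v ∈ B := by
      intro v hv
      obtain ⟨y, hy, z, hz, rfl⟩ := Submodule.mem_sup.1 hv
      obtain ⟨c, rfl⟩ := Submodule.mem_span_singleton.1 hz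
      have h1 : S.g.lin y ∈ B.restrictScalars k := by rw [← hVB]; exact ⟨y, hy, rfl⟩
      have h2 : S.g.lin (c • x) ∈ B := by
        have : S.g.lin (c • x) = c • S.g.lin x := map_smul (S.g.lin.restrictScalars k) c x
        rw [this]
        exact (B.restrictScalars k).smul_mem c (Submodule.mem_span_singleton_self _)
      rw [map_add]
      exact add_mem h1 h2
    obtain ⟨U, hU, hUK, hst⟩ := exists_stable S.X₂ s hs (LinearMap.ker S.g.lin) V hV (by
      intro a _ v hv
      have h1 : op a • S.g.lin v ∈ B.restrictScalars k := B.smul_mem _ (hVB' v hv)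
      rw [← hVB] at h1
      obtain ⟨v', hv', h'⟩ := h1
      have h' : S.g.lin v' = op a • S.g.lin v := h'
      refine ⟨op a • v - v', ?_, ?_⟩
      · rw [LinearMap.mem_ker, map_sub, map_smul, h', sub_self]
      · rw [sub_sub_cancel]; exact Submodule.mem_sup_left hv')
    have hUfin : Module.Finite k U := by
      have hle : U ≤ LinearMap.range S.f.lin := fun y hy => exact_apply hS y (hUK hy)
      have := hS.mono_f
      have hU' : (U.comap S.f.lin).FG := by
        apply Submodule.fg_of_fg_map_injective S.f.lin (injective_of_mono S.f)
        rwa [Submodule.map_comap_eq_of_le hle]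
      have := IsTorsion.finite_of_fg h₁ hU'
      refine Module.Finite.of_surjective
        ((S.f.lin.restrict (p := U.comap S.f.lin) (q := U) fun _ h => h).restrictScalars k) ?_
      rintro ⟨y, hy⟩
      obtain ⟨z, rfl⟩ := hle hy
      exact ⟨⟨z, hy⟩, rfl⟩
    have hW : (V ⊔ U.restrictScalars k).FG := hV.sup (Module.Finite.iff_fg.1 hUfin)
    have hWfin : Module.Finite k (V ⊔ U.restrictScalars k : Submodule k S.X₂) :=
      Module.Finite.iff_fg.2 hW
    have hle : (Submodule.span Aᵐᵒᵖ {x}).restrictScalars k ≤ V ⊔ U.restrictScalars k := by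
      intro y hy
      obtain ⟨a, rfl⟩ := Submodule.mem_span_singleton.1 hy
      exact hst a.unop x (Submodule.mem_sup_left (Submodule.mem_sup_right
        (Submodule.mem_span_singleton_self x)))
    exact Module.Finite.of_injective (Submodule.inclusion hle) (Submodule.inclusion_injective hle)

end Torsion

/-! ### Finitely presented graded modules over a graded coherent algebra -/

end GrMod

/-- A graded algebra is right graded coherent if every finitely generated homogeneous right ideal
is finitely presented. -/
class IsRightGradedCoherent (𝒜 : ℕ → Submodule k A) [GradedAlgebra 𝒜] : Prop where
  finitePresentation_of_fg : ∀ I : Submodule Aᵐᵒᵖ A, I.FG → I.IsHomogeneous 𝒜 →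
    Module.FinitePresentation Aᵐᵒᵖ I

namespace GrMod

variable {𝒜 : ℕ → Submodule k A}

variable (𝒜) in
/-- The full subcategory `gr(A)` of finitely presented modules in `Gr(A)`. -/
def gr : ObjectProperty (GrMod 𝒜) := fun M => Module.FinitePresentation Aᵐᵒᵖ M

section Coherent

/-- Every finitely generated graded submodule is finitely presented. -/
def IsCoh (M : GrMod 𝒜) : Prop :=
  ∀ N : Submodule Aᵐᵒᵖ M, M.IsHomog N → N.FG → Module.FinitePresentation Aᵐᵒᵖ N

lemma IsCoh.prod {M M' : GrMod 𝒜} (hM : M.IsCoh) (hM' : M'.IsCoh) : (M.prod M').IsCoh := by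
  intro N hN hfg
  let p : M.prod M' ⟶ M' := ⟨LinearMap.snd _ _ _, fun _ _ h => h.2⟩
  let j : M ⟶ M.prod M' := ⟨LinearMap.inl _ _ _, fun i _ h => ⟨h, (M'.deg i).zero_mem⟩⟩
  have := hM' (N.map p.lin) (hN.map p) (hfg.map _)
  let l : N →ₗ[Aᵐᵒᵖ] N.map p.lin := p.lin.restrict fun x hx => ⟨x, hx, rfl⟩
  have hl : Function.Surjective l := by
    rintro ⟨_, x, hx, rfl⟩
    exact ⟨⟨x, hx⟩, rfl⟩
  have hNfin : Module.Finite Aᵐᵒᵖ N := Module.Finite.iff_fg.2 hfg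
  have hker := Module.FinitePresentation.fg_ker l hl
  let e : N.comap j.lin ≃ₗ[Aᵐᵒᵖ] LinearMap.ker l :=
    LinearEquiv.ofBijective
      ((j.lin.restrict (p := N.comap j.lin) (q := N) fun x hx => hx).codRestrict (LinearMap.ker l)
        (fun x => Subtype.ext rfl))
      ⟨fun x y h => Subtype.ext (congrArg (fun z : LinearMap.ker l => (z : N).1.1) h), by
        rintro ⟨⟨⟨x, y⟩, hxy⟩, h⟩
        have hy : y = 0 := congrArg Subtype.val h
        subst hy
        exact ⟨⟨x, hxy⟩, rfl⟩⟩
  have hfin : Module.Finite Aᵐᵒᵖ (LinearMap.ker l) := Module.Finite.iff_fg.2 hker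
  have : Module.Finite Aᵐᵒᵖ (N.comap j.lin) := Module.Finite.equiv e.symm
  have := hM (N.comap j.lin) (hN.comap j) (Module.Finite.iff_fg.1 this)
  have : Module.FinitePresentation Aᵐᵒᵖ (LinearMap.ker l) :=
    (LinearEquiv.finitePresentation_iff (M := N.comap j.lin) (N := LinearMap.ker l) e).1 this
  exact Module.finitePresentation_of_ker l hl

lemma IsCoh.of_surjective {M M' : GrMod 𝒜} (hM : M.IsCoh) (f : M ⟶ M')
    (hf : Function.Surjective f.lin) (hk : (LinearMap.ker f.lin).FG) : M'.IsCoh := by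
  intro N hN hfg
  have hle : LinearMap.ker f.lin ≤ N.comap f.lin := fun x hx => by
    rw [Submodule.mem_comap, LinearMap.mem_ker.1 hx]; exact N.zero_mem
  have hfg' : (N.comap f.lin).FG := by
    apply Submodule.fg_of_fg_map_of_fg_inf_ker f.lin
    · rwa [Submodule.map_comap_eq_of_surjective hf]
    · rwa [inf_eq_right.2 hle]
  have := hM _ (hN.comap f) hfg'
  refine Module.finitePresentation_of_surjective
    (f.lin.restrict (p := N.comap f.lin) (q := N) fun x hx => hx) ?_ ?_
  · rintro ⟨y, hy⟩
    obtain ⟨x, rfl⟩ := hf y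
    exact ⟨⟨x, hy⟩, rfl⟩
  · apply Submodule.fg_of_fg_map_injective (N.comap f.lin).subtype Subtype.val_injective
    convert hk
    ext x
    constructor
    · rintro ⟨y, hy, rfl⟩
      exact congrArg Subtype.val hy
    · intro hx
      exact ⟨⟨x, hle hx⟩, Subtype.ext hx, rfl⟩

variable [GradedAlgebra 𝒜]

variable (𝒜) in
/-- The free graded module `A(-d)` on one generator of degree `d`. -/
def free (d : ℤ) : GrMod 𝒜 where
  carrier := A
  deg i := if d ≤ i then 𝒜 (i - d).toNat else ⊥
  isInternal := by
    refine isInternal_of_proj _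
      (fun i => if d ≤ i then GradedAlgebra.proj 𝒜 (i - d).toNat else 0) ?_ ?_ ?_
    · intro i x hx h
      split_ifs at hx h with hi
      · rwa [GradedAlgebra.proj_apply, DirectSum.decompose_of_mem_same _ hx] at h
      · exact hx
    · intro i j x hij hx
      by_cases hi : d ≤ i
      · by_cases hj : d ≤ j
        · rw [if_pos hj] at hx
          rw [if_pos hi, GradedAlgebra.proj_apply, DirectSum.decompose_of_mem_ne _ hx (by omega)]
        · rw [if_neg hj] at hx
          rw [show x = 0 from hx, map_zero]
      · rw [if_neg hi]; rfl
    · intro x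
      refine DirectSum.Decomposition.inductionOn 𝒜 (Submodule.zero_mem _) ?_
        (fun _ _ h h' => Submodule.add_mem _ h h') x
      intro m a
      refine Submodule.mem_iSup_of_mem (d + m) ?_
      rw [if_pos (by omega), show (d + m - d).toNat = m by omega]
      exact a.2
  smul_mem := by
    intro m i a x ha hx
    split_ifs at hx with hi
    · rw [if_pos (by omega), show (i + m - d).toNat = (i - d).toNat + m by omega]
      exact SetLike.mul_mem_graded hx ha
    · rw [show x = 0 from hx, smul_zero]
      exact Submodule.zero_mem _

lemma finite_free (d : ℤ) : Module.Finite Aᵐᵒᵖ (free 𝒜 d) :=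
  Module.Finite.equiv (opLinearEquiv Aᵐᵒᵖ : A ≃ₗ[Aᵐᵒᵖ] Aᵐᵒᵖ).symm

lemma mem_free_deg {d : ℤ} {m : ℕ} {a : A} (ha : a ∈ 𝒜 m) :
    (show (free 𝒜 d).carrier from a) ∈ (free 𝒜 d).deg (d + m) := by
  change a ∈ (if d ≤ d + (m : ℤ) then 𝒜 (d + m - d).toNat else ⊥)
  rw [if_pos (by omega), show (d + m - d).toNat = m by omega]
  exact ha

lemma isCoh_free [IsRightGradedCoherent 𝒜] (d : ℤ) : (free 𝒜 d).IsCoh := by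
  intro N hN hfg
  refine IsRightGradedCoherent.finitePresentation_of_fg (𝒜 := 𝒜) (N : Submodule Aᵐᵒᵖ A) hfg ?_
  intro m x hx
  have key : ∀ x : A, (free 𝒜 d).proj (d + m) x = (DirectSum.decompose 𝒜 x m).1 := by
    intro x
    refine DirectSum.Decomposition.inductionOn 𝒜
      (motive := fun x : A => (free 𝒜 d).proj (d + m) x = (DirectSum.decompose 𝒜 x m).1)
      ?_ ?_ ?_ x
    · rw [DirectSum.decompose_zero]
      exact map_zero ((free 𝒜 d).proj (d + m))
    · intro n a
      by_cases h : m = n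
      · subst h
        rw [DirectSum.decompose_of_mem_same _ a.2]
        exact proj_of_mem (mem_free_deg a.2)
      · rw [DirectSum.decompose_of_mem_ne _ a.2 (Ne.symm h)]
        exact proj_of_mem_ne (by omega) (mem_free_deg a.2)
    · intro x y hx hy
      rw [DirectSum.decompose_add, DirectSum.add_apply, Submodule.coe_add, ← hx, ← hy]
      exact map_add ((free 𝒜 d).proj (d + m)) x y
  rw [← key]
  exact hN.proj_mem hx _

/-- The morphism `A(-d) ⟶ M` given by an element of degree `d`. -/
def freeDesc {M : GrMod 𝒜} {d : ℤ} {x : M} (hx : x ∈ M.deg d) : free 𝒜 d ⟶ M where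
  lin :=
    { toFun := fun a : A => op a • x
      map_add' := fun (a b : A) => by
        change op (a + b) • x = op a • x + op b • x
        rw [MulOpposite.op_add, add_smul]
      map_smul' := fun b (a : A) => by
        change op (a * b.unop) • x = b • op a • x
        rw [MulOpposite.op_mul, mul_smul, op_unop] }
  map_mem i (a : A) ha := by
    change a ∈ (if d ≤ i then 𝒜 (i - d).toNat else ⊥) at ha
    change op a • x ∈ M.deg i
    split_ifs at ha with hi
    · have := M.smul_mem ha hx
      rwa [show d + ((i - d).toNat : ℤ) = i by omega] at this
    · rw [show a = 0 from ha, MulOpposite.op_zero, zero_smul]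
      exact Submodule.zero_mem _

lemma exists_cover [IsRightGradedCoherent 𝒜] (M : GrMod 𝒜) (N : Submodule Aᵐᵒᵖ M) (hN : N.FG) :
    ∃ (F : GrMod 𝒜) (f : F ⟶ M), F.IsCoh ∧ Module.Finite Aᵐᵒᵖ F ∧ N ≤ LinearMap.range f.lin := by
  have hsup : ∀ N N' : Submodule Aᵐᵒᵖ M,
      (∃ (F : GrMod 𝒜) (f : F ⟶ M), F.IsCoh ∧ Module.Finite Aᵐᵒᵖ F ∧ N ≤ LinearMap.range f.lin) →
      (∃ (F : GrMod 𝒜) (f : F ⟶ M), F.IsCoh ∧ Module.Finite Aᵐᵒᵖ F ∧ N' ≤ LinearMap.range f.lin) →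
      ∃ (F : GrMod 𝒜) (f : F ⟶ M), F.IsCoh ∧ Module.Finite Aᵐᵒᵖ F ∧
        N ⊔ N' ≤ LinearMap.range f.lin := by
    rintro N N' ⟨F, f, hF, hFfin, h⟩ ⟨F', f', hF', hF'fin, h'⟩
    refine ⟨F.prod F', ⟨f.lin.coprod f'.lin, fun i x hx =>
      add_mem (f.map_mem i _ hx.1) (f'.map_mem i _ hx.2)⟩, hF.prod hF',
      inferInstanceAs (Module.Finite Aᵐᵒᵖ (F × F')), ?_⟩
    change N ⊔ N' ≤ LinearMap.range (f.lin.coprod f'.lin)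
    rw [LinearMap.range_coprod]
    exact sup_le_sup h h'
  induction N, hN using Submodule.fg_induction with
  | singleton x =>
    refine hom_induction (p := fun x => ∃ (F : GrMod 𝒜) (f : F ⟶ M), F.IsCoh ∧
      Module.Finite Aᵐᵒᵖ F ∧ Submodule.span Aᵐᵒᵖ {x} ≤ LinearMap.range f.lin) x ?_ ?_ ?_
    · exact ⟨free 𝒜 0, 0, isCoh_free 0, finite_free _, by simp⟩
    · intro x y hx hy
      obtain ⟨F, f, hF, hF', h⟩ := hsup _ _ hx hy
      refine ⟨F, f, hF, hF', le_trans ?_ h⟩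
      rw [Submodule.span_singleton_le_iff_mem]
      exact add_mem (Submodule.mem_sup_left (Submodule.mem_span_singleton_self x))
        (Submodule.mem_sup_right (Submodule.mem_span_singleton_self y))
    · intro i x hx
      refine ⟨free 𝒜 i, freeDesc hx, isCoh_free i, finite_free _, ?_⟩
      rw [Submodule.span_singleton_le_iff_mem]
      exact ⟨(1 : A), one_smul _ x⟩
  | sup N N' _ _ h h' => exact hsup N N' h h'

/-- Over a right graded coherent algebra, finitely generated graded submodules of finitely
presented graded modules are finitely presented. -/
lemma isCoh_of_finitePresentation [IsRightGradedCoherent 𝒜] (M : GrMod 𝒜) (hM : gr 𝒜 M) :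
    M.IsCoh := by
  have : Module.FinitePresentation Aᵐᵒᵖ M := hM
  obtain ⟨F, f, hF, hfin, h⟩ := exists_cover M ⊤ Module.Finite.fg_top
  have hf : Function.Surjective f.lin := LinearMap.range_eq_top.1 (top_le_iff.1 h)
  exact hF.of_surjective f hf (Module.FinitePresentation.fg_ker f.lin hf)

/-- Isomorphic objects have linearly equivalent underlying modules. -/
def isoLin {M N : GrMod 𝒜} (e : M ≅ N) : M ≃ₗ[Aᵐᵒᵖ] N :=
  LinearEquiv.ofLinearMap e.hom.lin e.inv.lin (congrArg Hom.lin e.inv_hom_id)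
    (congrArg Hom.lin e.hom_inv_id)

instance : (gr 𝒜).IsClosedUnderIsomorphisms where
  of_iso e (_ : Module.FinitePresentation _ _) := Module.FinitePresentation.of_equiv (isoLin e)

instance : (gr 𝒜).ContainsZero where
  exists_zero := ⟨zero 𝒜, isZero_zero,
    inferInstanceAs (Module.FinitePresentation Aᵐᵒᵖ PUnit.{u + 1})⟩

instance [IsRightGradedCoherent 𝒜] : (gr 𝒜).IsClosedUnderKernels where
  kernels_le := by
    rintro _ ⟨f, c, hc, ⟨hX, hY⟩⟩
    rename_i X Y
    have e := IsLimit.conePointUniqueUpToIso (kernelIsLimit f) hc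
    refine (gr 𝒜).prop_of_iso e ?_
    have : Module.FinitePresentation Aᵐᵒᵖ X := hX
    have := isCoh_of_finitePresentation Y hY (LinearMap.range f.lin) (isHomog_range f)
      (Module.Finite.iff_fg.1 inferInstance)
    have hk := Module.FinitePresentation.fg_ker f.lin.rangeRestrict
      f.lin.surjective_rangeRestrict
    rw [LinearMap.ker_rangeRestrict] at hk
    exact isCoh_of_finitePresentation X hX _ (isHomog_ker f) hk

instance : (gr 𝒜).IsClosedUnderCokernels where
  cokernels_le := by
    rintro _ ⟨f, c, hc, ⟨hX, hY⟩⟩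
    rename_i X Y
    have e := IsColimit.coconePointUniqueUpToIso (cokernelIsColimit f) hc
    refine (gr 𝒜).prop_of_iso e ?_
    have : Module.FinitePresentation Aᵐᵒᵖ X := hX
    have : Module.FinitePresentation Aᵐᵒᵖ Y := hY
    refine Module.finitePresentation_of_surjective (LinearMap.range f.lin).mkQ
      (Submodule.mkQ_surjective _) ?_
    have h : (LinearMap.range f.lin).FG := Module.Finite.iff_fg.1 inferInstance
    rwa [← Submodule.ker_mkQ (LinearMap.range f.lin)] at h

instance : (gr 𝒜).IsClosedUnderFiniteProducts := by
  have : (gr 𝒜).IsClosedUnderBinaryProducts := ⟨by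
    rintro X ⟨p⟩
    let q := (IsLimit.postcomposeHomEquiv (diagramIsoPair p.diag) _).symm p.isLimit
    have e := IsLimit.conePointUniqueUpToIso (prodIsLimit _ _) q
    refine (gr 𝒜).prop_of_iso e ?_
    have h₁ : Module.FinitePresentation Aᵐᵒᵖ (p.diag.obj ⟨.left⟩) := p.prop_diag_obj _
    have h₂ : Module.FinitePresentation Aᵐᵒᵖ (p.diag.obj ⟨.right⟩) := p.prop_diag_obj _
    exact inferInstanceAs
      (Module.FinitePresentation Aᵐᵒᵖ (p.diag.obj ⟨.left⟩ × p.diag.obj ⟨.right⟩))⟩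
  exact .mk'

instance [IsRightGradedCoherent 𝒜] : PreservesFiniteLimits (gr 𝒜).ι :=
  have := (gr 𝒜).preservesKernels_ι
  Functor.preservesFiniteLimits_of_preservesKernels _

instance [IsRightGradedCoherent 𝒜] : PreservesFiniteColimits (gr 𝒜).ι :=
  have := (gr 𝒜).preservesCokernels_ι
  Functor.preservesFiniteColimits_of_preservesCokernels _

end Coherent

/-! ### The quotient categories -/

section Quotients

variable (𝒜) [GradedAlgebra 𝒜]

/-- The full subcategory `tors(A)` of torsion modules in `gr(A)`.  By the closure properties
above, `gr(A)` is abelian when `A` is right graded coherent. -/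
def tors : ObjectProperty (gr 𝒜).FullSubcategory := (Tors 𝒜).inverseImage (gr 𝒜).ι

variable [Algebra.FiniteType k A]

instance [IsRightGradedCoherent 𝒜] : (tors 𝒜).IsSerreClass :=
  inferInstanceAs ((Tors 𝒜).inverseImage (gr 𝒜).ι).IsSerreClass

/-- The quotient category `Qgr(A) = Gr(A) / Tors(A)`. -/
abbrev Qgr := (Tors 𝒜).isoModSerre.Localization

/-- The quotient functor `Gr(A) ⥤ Qgr(A)`. -/
abbrev Qgrπ : GrMod 𝒜 ⥤ Qgr 𝒜 := (Tors 𝒜).isoModSerre.Q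

/-- `Qgr(A)` is an abelian category. -/
noncomputable instance : Abelian (Qgr 𝒜) :=
  ObjectProperty.SerreClassLocalization.abelian (Qgrπ 𝒜) (Tors 𝒜)

variable [IsRightGradedCoherent 𝒜]

/-- The quotient category `qgr(A) = gr(A) / tors(A)`. -/
abbrev qgr := (tors 𝒜).isoModSerre.Localization

/-- The quotient functor `gr(A) ⥤ qgr(A)`. -/
abbrev qgrπ : (gr 𝒜).FullSubcategory ⥤ qgr 𝒜 := (tors 𝒜).isoModSerre.Q

end Quotients

end GrMod

end GradedModules

/-! ### Finitely presented objects -/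

section FinitelyPresented

universe v₁ u₁

variable {C : Type u₁} [Category.{v₁} C]

/-- An object `X` is of finite type if every family of subobjects with sum `X` has a finite
subfamily with sum `X`.  Sums of subobjects are least upper bounds of subobjects. -/
def IsFiniteType (X : C) : Prop :=
  ∀ S : Set (Subobject X), IsLUB S ⊤ → ∃ T ⊆ S, T.Finite ∧ IsLUB T ⊤

variable (C) in
/-- The finitely presented objects: objects `X` of finite type such that the kernel of every
epimorphism `Y ⟶ X` with `Y` of finite type is of finite type. -/
def fp [HasZeroMorphisms C] [HasKernels C] : ObjectProperty C := fun X =>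
  IsFiniteType X ∧ ∀ (Y : C) (p : Y ⟶ X), Epi p → IsFiniteType Y → IsFiniteType (kernel p)

end FinitelyPresented

/-! Everything rests on one finiteness fact, `fg_of_finite_quotient`: because `A` is finitely
generated as an algebra, a submodule of finite codimension in a finitely generated module is
finitely generated. A finitely generated torsion module is finite-dimensional, so a homogeneous
submodule of a finitely generated module with torsion quotient is finitely generated. Together with
coherence, the same fact makes every finite-dimensional graded module finitely presented.

For morphisms, this shrinks denominators: if `s : M' ⟶ M` is invertible modulo torsion and `M` is
finitely presented, then `s` can be precomposed so that its source is finitely presented too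
(`exists_gr_of_isoModSerre`). Fractions between finitely presented modules in `Qgr(A)` can therefore
be taken inside `gr(A)`, and the comparison functor is full and faithful.

For objects, every subobject of `π(M)` comes from a homogeneous submodule of `M` (`sbj_surjective`),
and these are compared up to torsion (`sbj_le_iff`). Hence finite type objects are, up to
isomorphism, the images of finitely generated modules (`isFiniteType_Qgrπ_obj`,
`exists_fg_of_isFiniteType`). By coherence a map from a finitely generated to a finitely presented
module has finitely generated kernel, so `π` sends finitely presented modules to finitely presented
objects (`fp_Qgrπ_obj`). Conversely, let `π(M)` be finitely presented with `M` finitely generated,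
and let a finitely presented `F` map onto `M` with kernel `K`. Then `π(K)` is of finite type, some
finitely generated `N ≤ K` has the same image, and `F/N` is a finitely presented module with `π(F/N)
≅ π(M)` (`exists_gr_iso_of_fp`). This gives essential surjectivity. -/

namespace GrMod

variable {k : Type w} [Field k] {A : Type u} [Ring A] [Algebra k A] {𝒜 : ℕ → Submodule k A}

/-! ### Finite-dimensional quotients over a finitely generated algebra -/

/-- Over a finitely generated algebra, submodules of finite codimension of finitely generated
modules are finitely generated. -/
lemma fg_of_finite_quotient [Algebra.FiniteType k A] (M : GrMod 𝒜) [Module.Finite Aᵐᵒᵖ M]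
    (K : Submodule Aᵐᵒᵖ M) [Module.Finite k (M ⧸ K)] : K.FG := by
  classical
  obtain ⟨s, hs⟩ := (inferInstance : Algebra.FiniteType k A).out
  obtain ⟨g, hg⟩ := (inferInstance : Module.Finite Aᵐᵒᵖ M).fg_top
  obtain ⟨t, ht⟩ := (inferInstance : Module.Finite k (M ⧸ K)).fg_top
  have hmk := Function.surjInv_eq K.mkQ_surjective
  -- The lifts of `t` make `V` map onto `M ⧸ K`; the generators `g` force the stable subspace `V +
  -- U` found below to be all of `M`.
  let V : Submodule k M :=
    Submodule.span k (Function.surjInv K.mkQ_surjective '' t) ⊔ Submodule.span k g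
  have hV : V.FG := Submodule.FG.sup
    ⟨t.image (Function.surjInv K.mkQ_surjective), by rw [Finset.coe_image]⟩ ⟨g, rfl⟩
  have hVtop : V.map (K.mkQ.restrictScalars k) = ⊤ := by
    rw [eq_top_iff, ← ht, Submodule.span_le]
    intro y hy
    exact ⟨_, Submodule.mem_sup_left (Submodule.subset_span ⟨y, hy, rfl⟩), hmk y⟩
  obtain ⟨U, hU, hUK, hst⟩ := exists_stable M s hs K V hV (by
    intro a _ v _
    obtain ⟨v', hv', h'⟩ : K.mkQ (op a • v) ∈ V.map (K.mkQ.restrictScalars k) := by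
      rw [hVtop]; trivial
    refine ⟨op a • v - v', ?_, by rwa [sub_sub_cancel]⟩
    rw [← Submodule.ker_mkQ K, LinearMap.mem_ker, map_sub, sub_eq_zero]
    exact h'.symm)
  have htop : ∀ x : M, x ∈ V ⊔ U.restrictScalars k := by
    let W : Submodule Aᵐᵒᵖ M :=
      { (V ⊔ U.restrictScalars k).toAddSubmonoid with
        smul_mem' := fun a x hx => hst a.unop x hx }
    have hW : (⊤ : Submodule Aᵐᵒᵖ M) ≤ W := by
      rw [← hg, Submodule.span_le]
      exact fun x hx => Submodule.mem_sup_left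
        (Submodule.mem_sup_right (Submodule.subset_span hx))
    exact fun x => hW trivial
  have hVK : (V ⊓ K.restrictScalars k).FG := by
    have : Module.Finite k V := Module.Finite.iff_fg.2 hV
    exact Module.Finite.iff_fg.1 (Module.Finite.of_injective
      (Submodule.inclusion (inf_le_left : V ⊓ K.restrictScalars k ≤ V))
      (Submodule.inclusion_injective _))
  obtain ⟨b, hb⟩ := hVK
  have hbK : ∀ x ∈ b, x ∈ K := fun x hx =>
    ((hb ▸ Submodule.subset_span hx : x ∈ V ⊓ K.restrictScalars k)).2
  -- Modular law: since `U ≤ K` and `V + U = M`, one has `K = (V ∩ K) + U`, where `V ∩ K` is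
  -- finite-dimensional.
  have : K = Submodule.span Aᵐᵒᵖ b ⊔ U := by
    refine le_antisymm (fun x hx => ?_) (sup_le (Submodule.span_le.2 hbK) hUK)
    obtain ⟨v, hv, u, hu, rfl⟩ := Submodule.mem_sup.1 (htop x)
    have hvK : v ∈ V ⊓ K.restrictScalars k :=
      ⟨hv, (Submodule.add_mem_iff_left K (hUK hu)).1 hx⟩
    rw [← hb] at hvK
    exact Submodule.add_mem_sup (Submodule.span_le_restrictScalars k Aᵐᵒᵖ _ hvK) hu
  rw [this]
  exact Submodule.FG.sup ⟨b, rfl⟩ hU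

lemma finite_of_isTorsion [GradedAlgebra 𝒜] {M : GrMod 𝒜} (hM : M.IsTorsion)
    [Module.Finite Aᵐᵒᵖ M] : Module.Finite k M := by
  have := hM.finite_of_fg (Module.Finite.fg_top (R := Aᵐᵒᵖ) (M := M))
  exact Module.Finite.of_surjective
    ((⊤ : Submodule Aᵐᵒᵖ M).subtype.restrictScalars k) fun x => ⟨⟨x, trivial⟩, rfl⟩

/-! ### Finitely presented covers over a coherent algebra -/

section Coherent

variable [GradedAlgebra 𝒜] [IsRightGradedCoherent 𝒜]

/-- Every finitely generated graded module is a quotient of a finitely presented one. -/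
lemma exists_finitePresentation_cover (M : GrMod 𝒜) [Module.Finite Aᵐᵒᵖ M] :
    ∃ (F : GrMod 𝒜) (f : F ⟶ M), gr 𝒜 F ∧ Function.Surjective f.lin := by
  obtain ⟨F, f, hF, hfin, h⟩ := exists_cover M ⊤ Module.Finite.fg_top
  refine ⟨F, f, ?_, LinearMap.range_eq_top.1 (top_le_iff.1 h)⟩
  have := hF ⊤ (isHomog_top F) Module.Finite.fg_top
  exact Module.FinitePresentation.of_equiv (Submodule.topEquiv (R := Aᵐᵒᵖ) (M := F))

/-- A finitely generated submodule is contained in a finitely generated homogeneous one. -/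
lemma exists_isHomog_fg_ge {M : GrMod 𝒜} {N : Submodule Aᵐᵒᵖ M} (hN : N.FG) :
    ∃ P : Submodule Aᵐᵒᵖ M, M.IsHomog P ∧ P.FG ∧ N ≤ P := by
  obtain ⟨F, f, _, hfin, h⟩ := exists_cover M N hN
  exact ⟨_, isHomog_range f, Module.Finite.iff_fg.1 inferInstance, h⟩

variable [Algebra.FiniteType k A]

/-- Over a finitely generated right graded coherent algebra, finite-dimensional graded modules
are finitely presented. -/
lemma finitePresentation_of_finite (M : GrMod 𝒜) [Module.Finite k M] : gr 𝒜 M := by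
  have : Module.Finite Aᵐᵒᵖ M := Module.Finite.of_restrictScalars_finite k Aᵐᵒᵖ M
  obtain ⟨F, f, hF, hf⟩ := exists_finitePresentation_cover M
  have : Module.FinitePresentation Aᵐᵒᵖ F := hF
  have : Module.Finite k (F ⧸ LinearMap.ker f.lin) := Module.Finite.of_injective
    ((f.lin.quotKerEquivOfSurjective hf).toLinearMap.restrictScalars k)
    (f.lin.quotKerEquivOfSurjective hf).injective
  -- The kernel of the cover has finite codimension in `F`, hence is finitely generated.
  exact Module.finitePresentation_of_surjective f.lin hf (fg_of_finite_quotient F _)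

end Coherent

/-! ### Torsion elements -/

section Torsion

/-- An element is torsion if it generates a finite-dimensional submodule. -/
def IsTorsionElem {M : GrMod 𝒜} (x : M) : Prop := Module.Finite k (Submodule.span Aᵐᵒᵖ {x})

lemma IsTorsionElem.of_mem {M : GrMod 𝒜} {x : M} {P : Submodule Aᵐᵒᵖ M} (hx : x ∈ P)
    [Module.Finite k P] : IsTorsionElem x :=
  finite_of_le (P := P) ((Submodule.span_singleton_le_iff_mem _ _).2 hx)

lemma IsTorsionElem.add {M : GrMod 𝒜} {x y : M} (hx : IsTorsionElem x) (hy : IsTorsionElem y) :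
    IsTorsionElem (x + y) := by
  have : Module.Finite k _ := hx
  have : Module.Finite k _ := hy
  have := finite_sup (Submodule.span Aᵐᵒᵖ {x}) (Submodule.span Aᵐᵒᵖ {y})
  exact .of_mem (add_mem (Submodule.mem_sup_left (Submodule.mem_span_singleton_self x))
    (Submodule.mem_sup_right (Submodule.mem_span_singleton_self y)))

lemma isTorsionElem_zero (M : GrMod 𝒜) : IsTorsionElem (0 : M) :=
  .of_mem (Submodule.zero_mem ⊥)

lemma isTorsionElem_map_iff {M N : GrMod 𝒜} (f : M ⟶ N) (hf : Function.Injective f.lin) (x : M) :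
    IsTorsionElem (f.lin x) ↔ IsTorsionElem x := by
  have e : Submodule.span Aᵐᵒᵖ {x} ≃ₗ[Aᵐᵒᵖ] Submodule.span Aᵐᵒᵖ {f.lin x} :=
    (Submodule.equivMapOfInjective f.lin hf _).trans
      (LinearEquiv.ofEq _ _ (by rw [Submodule.map_span, Set.image_singleton]))
  exact (Module.Finite.equiv_iff (e.restrictScalars k)).symm

lemma IsTorsionElem.map {M N : GrMod 𝒜} {x : M} (hx : IsTorsionElem x) (f : M ⟶ N) :
    IsTorsionElem (f.lin x) := by
  have : Module.Finite k (Submodule.span Aᵐᵒᵖ {x}) := hx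
  have : Module.Finite k ((Submodule.span Aᵐᵒᵖ {x}).map f.lin) := Module.Finite.of_surjective
    ((f.lin.submoduleMap (Submodule.span Aᵐᵒᵖ {x})).restrictScalars k)
    (f.lin.submoduleMap_surjective _)
  exact .of_mem (P := (Submodule.span Aᵐᵒᵖ {x}).map f.lin)
    ⟨x, Submodule.mem_span_singleton_self x, rfl⟩

variable [GradedAlgebra 𝒜]

/-- This reduces all later torsion conditions to elements, homogeneous or not. -/
lemma isTorsion_iff_isTorsionElem (M : GrMod 𝒜) : Tors 𝒜 M ↔ ∀ x : M, IsTorsionElem x :=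
  isTorsion_iff M

lemma tors_sub_iff (M : GrMod 𝒜) (N : Submodule Aᵐᵒᵖ M) (hN : M.IsHomog N) :
    Tors 𝒜 (M.sub N hN) ↔ ∀ x ∈ N, IsTorsionElem x := by
  rw [isTorsion_iff_isTorsionElem]
  have key (x : N) : IsTorsionElem (M := M.sub N hN) x ↔ IsTorsionElem (M := M) x.1 :=
    (isTorsionElem_map_iff (M.subι N hN) Subtype.val_injective x).symm
  exact ⟨fun h x hx => (key ⟨x, hx⟩).1 (h _), fun h x => (key x).2 (h x.1 x.2)⟩

lemma tors_quot_iff (M : GrMod 𝒜) (N : Submodule Aᵐᵒᵖ M) (hN : M.IsHomog N) :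
    Tors 𝒜 (M.quot N hN) ↔ ∀ x, IsTorsionElem ((M.quotπ N hN).lin x) := by
  rw [isTorsion_iff_isTorsionElem]
  exact ⟨fun h x => h _, fun h x => by
    obtain ⟨x, rfl⟩ := N.mkQ_surjective x
    exact h x⟩

/-! ### Morphisms killed or inverted modulo torsion -/

variable [Algebra.FiniteType k A]

lemma monoModSerre_iff {M N : GrMod 𝒜} (f : M ⟶ N) :
    (Tors 𝒜).monoModSerre f ↔ ∀ x, f.lin x = 0 → IsTorsionElem x := by
  have e : kernel f ≅ M.sub _ (isHomog_ker f) :=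
    IsLimit.conePointUniqueUpToIso (kernelIsKernel f) (kernelIsLimit f)
  rw [ObjectProperty.monoModSerre_iff, (Tors 𝒜).prop_iff_of_iso e, tors_sub_iff]
  rfl

lemma epiModSerre_iff {M N : GrMod 𝒜} (f : M ⟶ N) :
    (Tors 𝒜).epiModSerre f ↔
      ∀ x, IsTorsionElem ((N.quotπ _ (isHomog_range f)).lin x) := by
  have e : cokernel f ≅ N.quot _ (isHomog_range f) :=
    IsColimit.coconePointUniqueUpToIso (cokernelIsCokernel f) (cokernelIsColimit f)
  rw [ObjectProperty.epiModSerre_iff, (Tors 𝒜).prop_iff_of_iso e, tors_quot_iff]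

/-- A morphism dies in the quotient exactly when its image is torsion, and the categorical image
consists of the elements `f.lin x`. -/
lemma Qgrπ_map_eq_zero_iff {M N : GrMod 𝒜} (f : M ⟶ N) :
    (Qgrπ 𝒜).map f = 0 ↔ ∀ x, IsTorsionElem (f.lin x) := by
  rw [ObjectProperty.SerreClassLocalization.map_eq_zero_iff (Qgrπ 𝒜) (Tors 𝒜)]
  have hi := injective_of_mono (Abelian.image.ι f)
  have hp := surjective_of_epi (Abelian.factorThruImage f)
  have hf : ∀ x, (Abelian.image.ι f).lin ((Abelian.factorThruImage f).lin x) = f.lin x :=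
    fun x => congrArg (fun g => Hom.lin g x) (Abelian.image.fac f)
  rw [isTorsion_iff_isTorsionElem, hp.forall]
  refine forall_congr' fun x => ?_
  rw [← isTorsionElem_map_iff _ hi, hf]

variable [IsRightGradedCoherent 𝒜]

/-- The denominators of fractions with finitely generated target can be chosen finitely
generated. -/
lemma exists_finite_of_isoModSerre {M' M : GrMod 𝒜} (s : M' ⟶ M) (hs : (Tors 𝒜).isoModSerre s)
    [Module.Finite Aᵐᵒᵖ M] :
    ∃ (M'' : GrMod 𝒜) (t : M'' ⟶ M'), Module.Finite Aᵐᵒᵖ M'' ∧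
      (Tors 𝒜).isoModSerre (t ≫ s) := by
  classical
  have : Module.Finite Aᵐᵒᵖ (M.quot _ (isHomog_range s)) :=
    inferInstanceAs (Module.Finite Aᵐᵒᵖ (M ⧸ LinearMap.range s.lin))
  have hq : Tors 𝒜 (M.quot _ (isHomog_range s)) :=
    (tors_quot_iff _ _ _).2 ((epiModSerre_iff s).1 hs.2)
  -- The cokernel of `s` is torsion and finitely generated, so the range of `s` has finite
  -- codimension and is finitely generated. Lifting its generators to `M'` gives the new source.
  have : Module.Finite k (M ⧸ LinearMap.range s.lin) := finite_of_isTorsion hq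
  obtain ⟨b, hb⟩ := fg_of_finite_quotient M (LinearMap.range s.lin)
  have hb' : ∀ y ∈ b, ∃ x, s.lin x = y := fun y hy =>
    (hb ▸ Submodule.subset_span hy : y ∈ LinearMap.range s.lin)
  choose! x hx using hb'
  -- The chosen lifts need not be homogeneous, so their span is enlarged.
  obtain ⟨P, hP, hPfg, hle⟩ := exists_isHomog_fg_ge (M := M')
    (N := Submodule.span Aᵐᵒᵖ (b.image x : Finset M')) ⟨_, rfl⟩
  refine ⟨M'.sub P hP, M'.subι P hP, Module.Finite.iff_fg.2 hPfg, ?_, ?_⟩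
  · rw [monoModSerre_iff]
    intro y hy
    exact (isTorsionElem_map_iff (M'.subι P hP) Subtype.val_injective _).1
      ((monoModSerre_iff s).1 hs.1 _ hy)
  · have hr : LinearMap.range s.lin ≤ LinearMap.range (M'.subι P hP ≫ s).lin := by
      rw [← hb, Submodule.span_le]
      intro y hy
      exact ⟨(⟨x y, hle (Submodule.subset_span
        (Finset.mem_coe.2 (Finset.mem_image_of_mem x hy)))⟩ : P), hx y hy⟩
    rw [epiModSerre_iff]
    intro y
    -- No image is lost on restricting to `P`, so the cokernel of `s` maps onto the new cokernel.
    exact ((epiModSerre_iff s).1 hs.2 y).map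
      (quotDesc (M.quotπ _ (isHomog_range (M'.subι P hP ≫ s))) _ (isHomog_range s)
        fun z hz => (Submodule.Quotient.mk_eq_zero _).2 (hr hz))

/-- The denominators of fractions with finitely presented target can be chosen finitely
presented. -/
lemma exists_gr_of_isoModSerre {M' M : GrMod 𝒜} (s : M' ⟶ M) (hs : (Tors 𝒜).isoModSerre s)
    (hM : gr 𝒜 M) :
    ∃ (M'' : GrMod 𝒜) (t : M'' ⟶ M'), gr 𝒜 M'' ∧ (Tors 𝒜).isoModSerre (t ≫ s) := by
  have : Module.FinitePresentation Aᵐᵒᵖ M := hM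
  obtain ⟨M'', t, hfin, ht⟩ := exists_finite_of_isoModSerre s hs
  refine ⟨M'', t, ?_, ht⟩
  -- `M''` is an extension of the range of `f`, finitely presented by coherence, by the kernel of
  -- `f`. This kernel is finitely generated and torsion, hence finite-dimensional, hence finitely
  -- presented.
  let f := t ≫ s
  have := isCoh_of_finitePresentation M hM _ (isHomog_range f)
    (Module.Finite.iff_fg.1 inferInstance)
  have hk := Module.FinitePresentation.fg_ker f.lin.rangeRestrict
    f.lin.surjective_rangeRestrict
  rw [LinearMap.ker_rangeRestrict] at hk
  let K := M''.sub _ (isHomog_ker f)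
  have : Module.Finite Aᵐᵒᵖ K := Module.Finite.iff_fg.2 hk
  have : Module.Finite k K :=
    finite_of_isTorsion ((tors_sub_iff _ _ _).2 ((monoModSerre_iff f).1 ht.1))
  have hK : Module.FinitePresentation Aᵐᵒᵖ (LinearMap.ker f.lin) := finitePresentation_of_finite K
  rw [← LinearMap.ker_rangeRestrict] at hK
  exact Module.finitePresentation_of_ker f.lin.rangeRestrict f.lin.surjective_rangeRestrict

end Torsion

end GrMod

/-! ### Preliminaries on finite type objects and homogeneous submodules -/

lemma IsFiniteType.of_iso {C : Type*} [Category* C] {X Y : C} (e : X ≅ Y)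
    (hX : IsFiniteType X) : IsFiniteType Y := by
  let φ := Subobject.mapIsoToOrderIso e
  intro S hS
  obtain ⟨T, hTS, hT, hT'⟩ := hX (φ.symm '' S) (by
    have := φ.symm.isLUB_image'.2 hS
    rwa [map_top] at this)
  refine ⟨φ '' T, ?_, hT.image φ, ?_⟩
  · rintro _ ⟨t, ht, rfl⟩
    obtain ⟨y, hy, rfl⟩ := hTS ht
    rwa [φ.apply_symm_apply]
  · have := φ.isLUB_image'.2 hT'
    rwa [map_top] at this

namespace GrMod

variable {k : Type w} [Field k] {A : Type u} [Ring A] [Algebra k A] {𝒜 : ℕ → Submodule k A}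

lemma mono_of_injective {M N : GrMod 𝒜} (f : M ⟶ N) (hf : Function.Injective f.lin) : Mono f :=
  ⟨fun _ _ hgh => hom_ext fun x => hf (congrArg (fun φ => Hom.lin φ x) hgh)⟩

lemma epi_of_surjective {M N : GrMod 𝒜} (f : M ⟶ N) (hf : Function.Surjective f.lin) : Epi f :=
  ⟨fun _ _ hgh => hom_ext fun y => by
    obtain ⟨x, rfl⟩ := hf y
    exact congrArg (fun φ => Hom.lin φ x) hgh⟩

instance (M : GrMod 𝒜) (N : Submodule Aᵐᵒᵖ M) (hN : M.IsHomog N) : Mono (M.subι N hN) :=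
  mono_of_injective _ Subtype.val_injective

lemma subι_comp_quotπ (M : GrMod 𝒜) (N : Submodule Aᵐᵒᵖ M) (hN : M.IsHomog N) :
    M.subι N hN ≫ M.quotπ N hN = 0 :=
  hom_ext fun x => (Submodule.Quotient.mk_eq_zero N).2 x.2

/-- A homogeneous submodule is the kernel of the projection to the quotient. -/
def subιIsKernel (M : GrMod 𝒜) (N : Submodule Aᵐᵒᵖ M) (hN : M.IsHomog N) :
    IsLimit (KernelFork.ofι (M.subι N hN) (M.subι_comp_quotπ N hN)) :=
  KernelFork.IsLimit.ofι _ _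
    (fun g hg => subLift g _ _ fun x =>
      (Submodule.Quotient.mk_eq_zero N).1 (congrArg (fun h => Hom.lin h x) hg))
    (fun _ _ => rfl)
    (fun g hg m hm => by
      ext x
      exact Subtype.ext (congrArg (fun h => Hom.lin h x) hm))

lemma isHomog_sSup {M : GrMod 𝒜} (S : Set {N : Submodule Aᵐᵒᵖ M // M.IsHomog N}) :
    M.IsHomog (sSup (Subtype.val '' S)) := by
  intro i x hx
  change M.proj i x ∈ sSup (Subtype.val '' S)
  rw [sSup_eq_iSup'] at hx
  refine Submodule.iSup_induction _
    (motive := fun x => M.proj i x ∈ sSup (Subtype.val '' S)) hx ?_ ?_ ?_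
  · rintro ⟨_, N, hN, rfl⟩ x hx
    exact (le_sSup ⟨N, hN, rfl⟩ : N.1 ≤ sSup (Subtype.val '' S)) (N.2.proj_mem hx i)
  · rw [map_zero]; exact Submodule.zero_mem _
  · intro x y hx hy
    rw [map_add]; exact Submodule.add_mem _ hx hy

/-! ### Subobjects of `π(M)` and objects of finite type -/

section Subobjects

variable [GradedAlgebra 𝒜] [Algebra.FiniteType k A]

instance : PreservesFiniteLimits (Qgrπ 𝒜) :=
  ObjectProperty.SerreClassLocalization.preservesFiniteLimits (Qgrπ 𝒜) (Tors 𝒜)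

instance : PreservesFiniteColimits (Qgrπ 𝒜) :=
  ObjectProperty.SerreClassLocalization.preservesFiniteColimits (Qgrπ 𝒜) (Tors 𝒜)

instance : (Qgrπ 𝒜).EssSurj := Localization.essSurj _ (Tors 𝒜).isoModSerre

lemma isIso_Qgrπ_map_iff {M N : GrMod 𝒜} (f : M ⟶ N) :
    IsIso ((Qgrπ 𝒜).map f) ↔ (Tors 𝒜).isoModSerre f :=
  ObjectProperty.SerreClassLocalization.isIso_map_iff (Qgrπ 𝒜) (Tors 𝒜) f

/-- The subobject of `π(M)` given by a homogeneous submodule of `M`. -/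
noncomputable def sbj (M : GrMod 𝒜) (N : {N : Submodule Aᵐᵒᵖ M // M.IsHomog N}) :
    Subobject ((Qgrπ 𝒜).obj M) :=
  Subobject.mk ((Qgrπ 𝒜).map (M.subι N.1 N.2))

/-- By exactness, `π(P)` is the kernel of `π(M) ⟶ π(M/P)`; so containment means that the composite
`N ⟶ M ⟶ M/P` is killed by `π`, that is, has torsion image. -/
lemma sbj_le_iff {M : GrMod 𝒜} (N P : {N : Submodule Aᵐᵒᵖ M // M.IsHomog N}) :
    M.sbj N ≤ M.sbj P ↔ ∀ x ∈ N.1, IsTorsionElem ((M.quotπ P.1 P.2).lin x) := by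
  have key : (∀ x ∈ N.1, IsTorsionElem ((M.quotπ P.1 P.2).lin x)) ↔
      (Qgrπ 𝒜).map (M.subι N.1 N.2) ≫ (Qgrπ 𝒜).map (M.quotπ P.1 P.2) = 0 := by
    rw [← Functor.map_comp, Qgrπ_map_eq_zero_iff]
    exact ⟨fun h x => h x.1 x.2, fun h x hx => h (⟨x, hx⟩ : N.1)⟩
  rw [key]
  constructor
  · intro h
    rw [← Subobject.ofMkLEMk_comp h, Category.assoc, ← Functor.map_comp, subι_comp_quotπ,
      Functor.map_zero, comp_zero]
  · intro h
    obtain ⟨l, hl⟩ := KernelFork.IsLimit.lift'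
      (KernelFork.mapIsLimit _ (M.subιIsKernel P.1 P.2) (Qgrπ 𝒜)) _ h
    exact Subobject.mk_le_mk_of_comm l hl

lemma sbj_mono {M : GrMod 𝒜} {N P : {N : Submodule Aᵐᵒᵖ M // M.IsHomog N}} (h : N.1 ≤ P.1) :
    M.sbj N ≤ M.sbj P := by
  rw [sbj_le_iff]
  intro x hx
  have : (M.quotπ P.1 P.2).lin x = 0 := (Submodule.Quotient.mk_eq_zero P.1).2 (h hx)
  rw [this]
  exact isTorsionElem_zero _

lemma sbj_top (M : GrMod 𝒜) : M.sbj ⟨⊤, M.isHomog_top⟩ = ⊤ := by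
  have : IsIso (M.subι ⊤ M.isHomog_top) :=
    ⟨subLift (𝟙 M) _ _ fun _ => trivial, rfl, rfl⟩
  exact (Subobject.isIso_iff_mk_eq_top _).1 inferInstance

/-- Write the inclusion of a subobject as a fraction `π(s)⁻¹ π(f)`; the range of `f` is the required
submodule. -/
lemma sbj_surjective (M : GrMod 𝒜) : Function.Surjective M.sbj := by
  intro S
  obtain ⟨φ, hφ⟩ := Localization.exists_rightFraction (Qgrπ 𝒜) (Tors 𝒜).isoModSerre
    (((Qgrπ 𝒜).objObjPreimageIso (S : Qgr 𝒜)).hom ≫ S.arrow)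
  have hs : IsIso ((Qgrπ 𝒜).map φ.s) := (isIso_Qgrπ_map_iff _).2 φ.hs
  rw [← cancel_epi ((Qgrπ 𝒜).map φ.s),
    MorphismProperty.RightFraction.map_s_comp_map] at hφ
  refine ⟨⟨_, isHomog_range φ.f⟩, ?_⟩
  let p : φ.X' ⟶ M.sub _ (isHomog_range φ.f) := subLift φ.f _ _ fun x => ⟨x, rfl⟩
  have hp : p ≫ M.subι _ (isHomog_range φ.f) = φ.f := rfl
  have : Epi p := epi_of_surjective p (by rintro ⟨_, x, rfl⟩; exact ⟨x, rfl⟩)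
  have : Mono ((Qgrπ 𝒜).map φ.f) := by rw [← hφ]; infer_instance
  -- The corestriction `p` of `f` to its range is epi, and `π(p)` is also mono because `π(f)` is;
  -- hence `π(p)` is invertible.
  have : Mono ((Qgrπ 𝒜).map p) := by
    rw [← hp, Functor.map_comp] at this
    exact mono_of_mono _ ((Qgrπ 𝒜).map (M.subι _ (isHomog_range φ.f)))
  have : IsIso ((Qgrπ 𝒜).map p) := isIso_of_mono_of_epi _
  rw [← hp, Functor.map_comp] at hφ
  refine (Subobject.mk_eq_mk_of_comm _ S.arrow ((asIso ((Qgrπ 𝒜).map p)).symm ≪≫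
    asIso ((Qgrπ 𝒜).map φ.s) ≪≫ (Qgrπ 𝒜).objObjPreimageIso (S : Qgr 𝒜)) ?_).trans
    (Subobject.mk_arrow S)
  simp only [Iso.trans_hom, Iso.symm_hom, asIso_inv, asIso_hom, Category.assoc]
  rw [IsIso.inv_comp_eq]
  exact hφ

/-- Every upper bound is some `sbj P`. Elements that become torsion modulo `P` are closed under
addition, so a bound for all members of `S` also bounds their sum. -/
lemma isLUB_image_sbj_iff {M : GrMod 𝒜} (S : Set {N : Submodule Aᵐᵒᵖ M // M.IsHomog N}) :
    IsLUB (M.sbj '' S) ⊤ ↔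
      M.sbj ⟨sSup (Subtype.val '' S), isHomog_sSup S⟩ = ⊤ := by
  constructor
  · intro h
    refine top_le_iff.1 (h.2 ?_)
    rintro _ ⟨N, hN, rfl⟩
    exact sbj_mono (le_sSup ⟨N, hN, rfl⟩)
  · intro h
    refine ⟨fun _ _ => le_top, fun B hB => ?_⟩
    obtain ⟨P, rfl⟩ := M.sbj_surjective B
    rw [← h, sbj_le_iff]
    intro x hx
    replace hx : x ∈ sSup (Subtype.val '' S) := hx
    rw [sSup_eq_iSup'] at hx
    refine Submodule.iSup_induction _
      (motive := fun x => IsTorsionElem ((M.quotπ P.1 P.2).lin x)) hx ?_ ?_ ?_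
    · rintro ⟨_, N, hN, rfl⟩ x hx
      exact (sbj_le_iff _ _).1 (hB ⟨N, hN, rfl⟩) x hx
    · rw [map_zero]; exact isTorsionElem_zero _
    · intro x y hx hy
      rw [map_add]; exact hx.add hy

lemma sbj_eq_top_iff {M : GrMod 𝒜} (N : {N : Submodule Aᵐᵒᵖ M // M.IsHomog N}) :
    M.sbj N = ⊤ ↔ Tors 𝒜 (M.quot N.1 N.2) := by
  rw [← top_le_iff, ← sbj_top, sbj_le_iff, tors_quot_iff]
  simp

lemma isIso_of_sbj_eq_top {M : GrMod 𝒜} {N : {N : Submodule Aᵐᵒᵖ M // M.IsHomog N}}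
    (h : M.sbj N = ⊤) : IsIso ((Qgrπ 𝒜).map (M.subι N.1 N.2)) :=
  (Subobject.isIso_iff_mk_eq_top _).2 h

/-- The images in `Qgr(A)` of finitely generated modules are of finite type. -/
lemma isFiniteType_Qgrπ_obj (M : GrMod 𝒜) [Module.Finite Aᵐᵒᵖ M] :
    IsFiniteType ((Qgrπ 𝒜).obj M) := by
  intro S hS
  obtain ⟨S, rfl⟩ : ∃ S', S = M.sbj '' S' := ⟨_, (Set.image_preimage_eq S M.sbj_surjective).symm⟩
  rw [isLUB_image_sbj_iff, sbj_eq_top_iff] at hS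
  have : Module.Finite k (M ⧸ sSup (Subtype.val '' S)) :=
    have : Module.Finite Aᵐᵒᵖ (M.quot _ (isHomog_sSup S)) :=
      inferInstanceAs (Module.Finite Aᵐᵒᵖ (M ⧸ sSup (Subtype.val '' S)))
    finite_of_isTorsion hS
  -- The sum of the family is only cofinite in `M`, but it is finitely generated, hence compact in
  -- the submodule lattice: finitely many members already have the same sum.
  have hfg := fg_of_finite_quotient M (sSup (Subtype.val '' S))
  obtain ⟨T, hTS, hT⟩ := (CompleteLattice.isCompactElement_iff_exists_le_sSup_of_le_sSup _ _).1
    ((Submodule.fg_iff_compact _).1 hfg) (Subtype.val '' S) le_rfl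
  obtain ⟨T', hT'S, hT'fin, hT'⟩ := T.finite_toSet.exists_subset_finite_image_eq hTS
  refine ⟨M.sbj '' T', Set.image_mono hT'S, hT'fin.image _, ?_⟩
  rw [isLUB_image_sbj_iff]
  refine top_le_iff.1 (le_trans (((sbj_eq_top_iff ⟨_, _⟩).2 hS).ge) (sbj_mono ?_))
  change sSup (Subtype.val '' S) ≤ sSup (Subtype.val '' T')
  rwa [hT', ← Finset.sup_id_eq_sSup]

/-- Objects of finite type of `Qgr(A)` are images of finitely generated modules.  More precisely,
`π(M)` of finite type is the image of a finitely generated homogeneous submodule of `M`. -/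
lemma exists_fg_of_isFiniteType (M : GrMod 𝒜) (hM : IsFiniteType ((Qgrπ 𝒜).obj M)) :
    ∃ (N : Submodule Aᵐᵒᵖ M) (hN : M.IsHomog N), N.FG ∧
      IsIso ((Qgrπ 𝒜).map (M.subι N hN)) := by
  -- Finite type is applied to the family of all finitely generated homogeneous submodules, whose
  -- sum is `M` since homogeneous elements generate.
  obtain ⟨T, hTS, hT, hT'⟩ := hM (M.sbj '' {N | N.1.FG}) (by
    rw [isLUB_image_sbj_iff, ← top_le_iff, ← sbj_top]
    refine sbj_mono fun x _ => ?_
    refine hom_induction (p := fun x => x ∈ sSup (Subtype.val ''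
      {N : {N : Submodule Aᵐᵒᵖ M // M.IsHomog N} | N.1.FG})) x (Submodule.zero_mem _)
      (fun x y => Submodule.add_mem _) fun i x hx => ?_
    have h : Submodule.span Aᵐᵒᵖ {x} ∈ Subtype.val ''
        {N : {N : Submodule Aᵐᵒᵖ M // M.IsHomog N} | N.1.FG} :=
      ⟨⟨_, isHomog_span_singleton hx⟩, Submodule.fg_span_singleton x, rfl⟩
    exact le_sSup h (Submodule.mem_span_singleton_self x))
  obtain ⟨T', hT'S, hT'fin, rfl⟩ := hT.exists_subset_finite_image_eq hTS
  rw [isLUB_image_sbj_iff] at hT'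
  refine ⟨_, _, ?_, isIso_of_sbj_eq_top hT'⟩
  change (sSup (Subtype.val '' T')).FG
  rw [sSup_image, ← hT'fin.coe_toFinset]
  exact Submodule.fg_biSup hT'fin.toFinset _ (fun N hN => hT'S (by simpa using hN))

end Subobjects

end GrMod

/-! ### Finitely presented objects of `Qgr(A)` -/

lemma fp_of_iso {C : Type*} [Category* C] [HasZeroMorphisms C] [HasKernels C] {X Y : C}
    (e : X ≅ Y) (hX : fp C X) : fp C Y := by
  refine ⟨hX.1.of_iso e, fun Z p hp hZ => ?_⟩
  exact (hX.2 Z (p ≫ e.inv) inferInstance hZ).of_iso (kernelCompMono p e.inv)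

namespace GrMod

variable {k : Type w} [Field k] {A : Type u} [Ring A] [Algebra k A] {𝒜 : ℕ → Submodule k A}
  [GradedAlgebra 𝒜] [Algebra.FiniteType k A]

lemma exists_finite_iso_of_isFiniteType (X : Qgr 𝒜) (hX : IsFiniteType X) :
    ∃ M : GrMod 𝒜, Module.Finite Aᵐᵒᵖ M ∧ Nonempty ((Qgrπ 𝒜).obj M ≅ X) := by
  let e := (Qgrπ 𝒜).objObjPreimageIso X
  obtain ⟨N, hN, hfg, _⟩ := exists_fg_of_isFiniteType _ (hX.of_iso e.symm)
  exact ⟨_, Module.Finite.iff_fg.2 hfg, ⟨asIso ((Qgrπ 𝒜).map (subι _ N hN)) ≪≫ e⟩⟩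

/-- The kernel of `π(f)` is the image of the kernel of `f`. -/
noncomputable def kernelQgrπIso {M N : GrMod 𝒜} (f : M ⟶ N) :
    (Qgrπ 𝒜).obj (M.sub _ (isHomog_ker f)) ≅ kernel ((Qgrπ 𝒜).map f) :=
  IsLimit.conePointUniqueUpToIso (KernelFork.mapIsLimit _ (kernelIsLimit f) (Qgrπ 𝒜))
    (limit.isLimit _)

variable [IsRightGradedCoherent 𝒜]

/-- The images in `Qgr(A)` of finitely presented modules are finitely presented. -/
lemma fp_Qgrπ_obj (M : GrMod 𝒜) (hM : gr 𝒜 M) : fp (Qgr 𝒜) ((Qgrπ 𝒜).obj M) := by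
  have : Module.FinitePresentation Aᵐᵒᵖ M := hM
  refine ⟨isFiniteType_Qgrπ_obj M, fun Y p hp hY => ?_⟩
  obtain ⟨N, hN, ⟨e⟩⟩ := exists_finite_iso_of_isFiniteType Y hY
  obtain ⟨φ, hφ⟩ := Localization.exists_rightFraction (Qgrπ 𝒜) (Tors 𝒜).isoModSerre (e.hom ≫ p)
  -- With a finitely generated source, the epimorphism becomes `π(f)` for a genuine `f : N' ⟶ M`, up
  -- to an isomorphism of the source. Its kernel is then `π(ker f)`, and `ker f` is finitely
  -- generated because the range of `f` is finitely presented.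
  obtain ⟨N', t, hN', ht⟩ := exists_finite_of_isoModSerre φ.s φ.hs
  have : IsIso ((Qgrπ 𝒜).map (t ≫ φ.s)) := (isIso_Qgrπ_map_iff _).2 ht
  let f := t ≫ φ.f
  have hf : ((Qgrπ 𝒜).map (t ≫ φ.s) ≫ e.hom) ≫ p = (Qgrπ 𝒜).map f := by
    rw [Functor.map_comp, Category.assoc, Category.assoc, hφ,
      MorphismProperty.RightFraction.map_s_comp_map, ← Functor.map_comp]
  have := isCoh_of_finitePresentation M hM _ (isHomog_range f)
    (Module.Finite.iff_fg.1 inferInstance)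
  have hk := Module.FinitePresentation.fg_ker f.lin.rangeRestrict
    f.lin.surjective_rangeRestrict
  rw [LinearMap.ker_rangeRestrict] at hk
  have : Module.Finite Aᵐᵒᵖ (N'.sub _ (isHomog_ker f)) := Module.Finite.iff_fg.2 hk
  exact (isFiniteType_Qgrπ_obj (N'.sub _ (isHomog_ker f))).of_iso (kernelQgrπIso f ≪≫
    kernelIsoOfEq hf.symm ≪≫ kernelIsIsoComp _ _)

/-- Finitely presented objects of `Qgr(A)` are images of finitely presented modules. -/
lemma exists_gr_iso_of_fp (X : Qgr 𝒜) (hX : fp (Qgr 𝒜) X) :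
    ∃ M : GrMod 𝒜, gr 𝒜 M ∧ Nonempty ((Qgrπ 𝒜).obj M ≅ X) := by
  obtain ⟨M, hM, ⟨e⟩⟩ := exists_finite_iso_of_isFiniteType X hX.1
  obtain ⟨F, f, hF, hf⟩ := exists_finitePresentation_cover M
  have : Module.FinitePresentation Aᵐᵒᵖ F := hF
  have : Epi f := epi_of_surjective f hf
  have hK : IsFiniteType ((Qgrπ 𝒜).obj (F.sub _ (isHomog_ker f))) :=
    ((fp_of_iso e.symm hX).2 _ ((Qgrπ 𝒜).map f) inferInstance
      (isFiniteType_Qgrπ_obj F)).of_iso (kernelQgrπIso f).symm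
  -- The kernel of `f` itself need not be finitely generated; dividing `F` by `N` instead gives a
  -- finitely presented module.
  obtain ⟨N, hN, hfg, hiso⟩ := exists_fg_of_isFiniteType _ hK
  let i := subι _ N hN ≫ F.subι _ (isHomog_ker f)
  have hfin : Module.Finite Aᵐᵒᵖ N := Module.Finite.iff_fg.2 hfg
  refine ⟨F.quot _ (isHomog_range i), ?_, ⟨?_ ≪≫ e⟩⟩
  · have h : (LinearMap.range i.lin).FG := by
      rw [LinearMap.range_eq_map]
      exact (Module.Finite.fg_top (R := Aᵐᵒᵖ) (M := N)).map i.lin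
    rw [← Submodule.ker_mkQ (LinearMap.range i.lin)] at h
    exact Module.finitePresentation_of_surjective (LinearMap.range i.lin).mkQ
      (Submodule.mkQ_surjective _) h
  · let q : F.quot _ (isHomog_range i) ⟶ M := quotDesc f _ _ (by
      rintro _ ⟨x, rfl⟩
      exact x.1.2)
    have hq : (Tors 𝒜).isoModSerre q := by
      have : Epi q := epi_of_surjective q fun y => by
        obtain ⟨x, rfl⟩ := hf y
        exact ⟨(LinearMap.range i.lin).mkQ x, rfl⟩
      -- The kernel of `q` is `ker f / N`, which is torsion because `π` inverts the inclusion of `N`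
      -- in `ker f`.
      rw [ObjectProperty.isoModSerre_iff_of_epi, monoModSerre_iff]
      intro x hx
      obtain ⟨x, rfl⟩ := (LinearMap.range i.lin).mkQ_surjective x
      have hx' : x ∈ LinearMap.ker f.lin := hx
      have h := (epiModSerre_iff _).1 ((isIso_Qgrπ_map_iff _).1 hiso).2
        (⟨x, hx'⟩ : LinearMap.ker f.lin)
      exact h.map (quotDesc (F.subι _ (isHomog_ker f) ≫ F.quotπ _ (isHomog_range i)) _ _ (by
        rintro _ ⟨y, rfl⟩
        exact (Submodule.Quotient.mk_eq_zero _).2 ⟨y, rfl⟩))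
    have := (isIso_Qgrπ_map_iff q).2 hq
    exact asIso ((Qgrπ 𝒜).map q)

/-! ### The comparison functor -/

/-- The inclusion of `gr(A)` is exact, so kernels and cokernels may be computed in `Gr(A)`. -/
lemma tors_isoModSerre_iff {M N : (gr 𝒜).FullSubcategory} (f : M ⟶ N) :
    (tors 𝒜).isoModSerre f ↔ (Tors 𝒜).isoModSerre ((gr 𝒜).ι.map f) :=
  and_congr ((Tors 𝒜).prop_iff_of_iso (PreservesKernel.iso (gr 𝒜).ι f))
    ((Tors 𝒜).prop_iff_of_iso (PreservesCokernel.iso (gr 𝒜).ι f))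

lemma isInvertedBy_ι_comp_Qgrπ :
    (tors 𝒜).isoModSerre.IsInvertedBy ((gr 𝒜).ι ⋙ Qgrπ 𝒜) := fun _ _ f hf =>
  (isIso_Qgrπ_map_iff _).2 ((tors_isoModSerre_iff f).1 hf)

variable (𝒜) in
/-- The functor `qgr(A) ⥤ Qgr(A)` induced by the inclusion `gr(A) ⥤ Gr(A)`. -/
noncomputable def qgrToQgr : qgr 𝒜 ⥤ Qgr 𝒜 :=
  Localization.lift ((gr 𝒜).ι ⋙ Qgrπ 𝒜) isInvertedBy_ι_comp_Qgrπ (qgrπ 𝒜)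

variable (𝒜) in
/-- The comparison functor is compatible with the quotient functors. -/
noncomputable def qgrπCompQgrToQgrIso : qgrπ 𝒜 ⋙ qgrToQgr 𝒜 ≅ (gr 𝒜).ι ⋙ Qgrπ 𝒜 :=
  Localization.fac ((gr 𝒜).ι ⋙ Qgrπ 𝒜) isInvertedBy_ι_comp_Qgrπ (qgrπ 𝒜)

instance : (qgrπ 𝒜).EssSurj := Localization.essSurj _ (tors 𝒜).isoModSerre

instance : (qgrToQgr 𝒜).Additive := by
  rw [Localization.functor_additive_iff (qgrπ 𝒜) (tors 𝒜).isoModSerre]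
  exact Functor.additive_of_iso (qgrπCompQgrToQgrIso 𝒜).symm

/-- By additivity and calculus of fractions it suffices to treat an `f` in `gr(A)` with `π(f) = 0`.
Such an `f` is annihilated by precomposition with some `s` invertible modulo torsion, and the source
of `s` can be made finitely presented, so `f` already vanishes in `qgr(A)`. -/
instance : (qgrToQgr 𝒜).Faithful :=
  Functor.faithful_of_comp_cancel_zero_of_hasLeftCalculusOfFractions (qgrπ 𝒜)
    (tors 𝒜).isoModSerre _ fun M N f hf => by
  have h : (Qgrπ 𝒜).map ((gr 𝒜).ι.map f) = 0 := by
    have := (qgrπCompQgrToQgrIso 𝒜).hom.naturality f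
    rw [Functor.comp_map, hf, zero_comp] at this
    exact (cancel_epi ((qgrπCompQgrToQgrIso 𝒜).hom.app M)).1 (this.symm.trans comp_zero.symm)
  rw [ObjectProperty.SerreClassLocalization.map_eq_zero_iff (Qgrπ 𝒜) (Tors 𝒜),
    ← ObjectProperty.exists_isoModSerre_comp_eq_zero_iff (Tors 𝒜)] at h
  obtain ⟨M', s, hs, h⟩ := h
  obtain ⟨M'', t, hM'', ht⟩ := exists_gr_of_isoModSerre s hs M.property
  rw [ObjectProperty.SerreClassLocalization.map_eq_zero_iff (qgrπ 𝒜) (tors 𝒜),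
    ← ObjectProperty.exists_isoModSerre_comp_eq_zero_iff (tors 𝒜)]
  refine ⟨⟨M'', hM''⟩, ObjectProperty.homMk (t ≫ s), (tors_isoModSerre_iff _).2 ht, ?_⟩
  apply (gr 𝒜).ι.map_injective
  rw [Functor.map_comp, Functor.map_zero]
  change (t ≫ s) ≫ (gr 𝒜).ι.map f = 0
  rw [Category.assoc, h, comp_zero]

/-- A morphism between images of finitely presented modules is a fraction; after its denominator is
shrunk into `gr(A)`, the same fraction makes sense in `qgr(A)`. -/
instance : (qgrToQgr 𝒜).Full :=
  Functor.full_of_comp_essSurj _ (qgrπ 𝒜) fun M N φ => by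
  let e := qgrπCompQgrToQgrIso 𝒜
  obtain ⟨ψ, hψ⟩ := Localization.exists_rightFraction (Qgrπ 𝒜) (Tors 𝒜).isoModSerre
    (e.inv.app M ≫ φ ≫ e.hom.app N)
  obtain ⟨M', t, hM', ht⟩ := exists_gr_of_isoModSerre ψ.s ψ.hs M.property
  let s : (⟨M', hM'⟩ : (gr 𝒜).FullSubcategory) ⟶ M := ObjectProperty.homMk (t ≫ ψ.s)
  let f : (⟨M', hM'⟩ : (gr 𝒜).FullSubcategory) ⟶ N := ObjectProperty.homMk (t ≫ ψ.f)
  have hs : (tors 𝒜).isoModSerre s := (tors_isoModSerre_iff s).2 ht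
  have : IsIso ((qgrπ 𝒜).map s) := Localization.inverts (qgrπ 𝒜) _ s hs
  refine ⟨inv ((qgrπ 𝒜).map s) ≫ (qgrπ 𝒜).map f, ?_⟩
  -- Conjugating by the comparison isomorphism `e` turns the claim into an identity of fractions in
  -- `Qgr(A)`.
  rw [Functor.map_comp, Functor.map_inv, IsIso.inv_comp_eq, ← cancel_mono (e.hom.app N),
    ← cancel_epi (e.inv.app ⟨M', hM'⟩)]
  have h₁ := e.hom.naturality f
  have h₂ := e.inv.naturality s
  simp only [Functor.comp_map] at h₁ h₂
  rw [h₁, Iso.inv_hom_id_app_assoc, Category.assoc, ← reassoc_of% h₂, hψ]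
  change (Qgrπ 𝒜).map (t ≫ ψ.f) = (Qgrπ 𝒜).map (t ≫ ψ.s) ≫ _
  rw [Functor.map_comp, Functor.map_comp, Category.assoc,
    MorphismProperty.RightFraction.map_s_comp_map]

variable (𝒜) in
/-- The comparison functor `qgr(A) ⥤ fp(Qgr(A))`. -/
noncomputable def qgrToFp : qgr 𝒜 ⥤ (fp (Qgr 𝒜)).FullSubcategory :=
  (fp (Qgr 𝒜)).lift (qgrToQgr 𝒜) fun X =>
    -- Each object of `qgr(A)` is isomorphic to the image of a finitely presented module, so
    -- `fp_Qgrπ_obj` transfers to it.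
    fp_of_iso ((qgrπCompQgrToQgrIso 𝒜).symm.app _ ≪≫
      (qgrToQgr 𝒜).mapIso ((qgrπ 𝒜).objObjPreimageIso X))
      (fp_Qgrπ_obj _ ((qgrπ 𝒜).objPreimage X).property)

instance : (qgrToFp 𝒜).Faithful := inferInstanceAs ((fp (Qgr 𝒜)).lift _ _).Faithful

instance : (qgrToFp 𝒜).Full := inferInstanceAs ((fp (Qgr 𝒜)).lift _ _).Full

instance : (qgrToFp 𝒜).EssSurj where
  mem_essImage X := by
    obtain ⟨M, hM, ⟨e⟩⟩ := exists_gr_iso_of_fp X.obj X.property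
    exact ⟨(qgrπ 𝒜).obj ⟨M, hM⟩,
      ⟨ObjectProperty.isoMk _ ((qgrπCompQgrToQgrIso 𝒜).app ⟨M, hM⟩ ≪≫ e)⟩⟩

instance : (qgrToFp 𝒜).IsEquivalence where

end GrMod

theorem mainTheorem6 {k : Type w} [Field k] {A : Type u} [Ring A] [Algebra k A]
    (𝒜 : ℕ → Submodule k A) [GradedAlgebra 𝒜] [Algebra.FiniteType k A]
    [IsRightGradedCoherent 𝒜] :
    ∃ E : GrMod.qgr 𝒜 ≌ (fp (GrMod.Qgr 𝒜)).FullSubcategory,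
      Nonempty (GrMod.qgrπ 𝒜 ⋙ E.functor ⋙ (fp (GrMod.Qgr 𝒜)).ι ≅
        (GrMod.gr 𝒜).ι ⋙ GrMod.Qgrπ 𝒜) :=
  ⟨(GrMod.qgrToFp 𝒜).asEquivalence, ⟨GrMod.qgrπCompQgrToQgrIso 𝒜⟩⟩
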